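/- For real $a,b,c$ with $c\ne 0,-1,-2,\dots$ let $F(a,b,c;z)=\sum_{n\ge 0}\frac{(a)_n(b)_n}{(c)_n}\frac{z^n}{n!}$ for $|z|<1$, continued analytically to $\mathbb C\setminus[1,+\infty)$, where $(x)_0=1$ and $(x)_n=x(x+1)\cdots(x+n-1)$. Let $0<\alpha,\beta<1$ and $0<\gamma\le 1$ with $\alpha+\beta+\gamma>2$, and put $$a=\frac{\alpha+\beta-\gamma}2,\qquad b=\frac{\alpha+\beta+\gamma-2}2,\qquad c=\alpha,$$ $$K_1=-\frac{\Gamma(c-a)\Gamma(c-b)}{\Gamma(c)\Gamma(c-a-b)},\qquad K_2=-\frac{\Gamma(a+1-c)\Gamma(b+1-c)}{\Gamma(1-c)\Gamma(a+b+1-c)},$$ $$K_3=\sqrt{\frac{\sin(\pi a)\sin(\pi b)}{\sin(\pi(c-a))\sin(\pi(c-b))}}\cdot\frac{\Gamma(a+b+1-c)\Gamma(c)}{\Gamma(a)\Gamma(b)},$$ $$\varphi_1(z)=F(a,b,c;z),\qquad \varphi_2(z)=F(a,b,a+b-c+1;1-z).$$ Let $\lambda=\lambda_{\alpha,\beta,\gamma}$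 be the generalized hyperbolic density (curvature $-4$) on the sphere with conical singularities of orders $\alpha,\beta,\gamma$ at $0,1,\infty$, given on $\mathbb C\setminus\{0,1\}$ by $$\lambda(z)=\frac1{|z|^\alpha|1-z|^\beta}\cdot\frac{K_3}{K_1|\varphi_1(z)|^2+K_2|\varphi_2(z)|^2+2\,\mathrm{Re}(\varphi_1(z)\varphi_2(\bar z))},$$ the formula being extended by continuity across the slits $(-\infty,0)$ and $(1,+\infty)$. Let $u=\log\lambda$, $\partial=\partial/\partial z=\frac12(\partial_x-i\partial_y)$ and $\bar\partial=\partial/\partial\bar z=\frac12(\partial_x+i\partial_y)$. Then $\lambda>0$ and $u$ is $C^\infty$ in a punctured neighbourhood of $0$, and for all integers $m,n\ge1$: (i) $\displaystyle\lim_{z\to0}z^n\partial^nu(z)=\frac\alpha2(-1)^n(n-1)!=\lim_{z\to0}\bar z^n\bar\partial^nu(z)$; (ii) $\displaystyle\lim_{z\to0}\bar z^mz^n|z|^{2\alpha-2}\,\bar\partial^m\partial^nu(z)=\frac{(-1)^{n+m}(c)_{n-1}(c)_{m-1}K_2^2}{1-K_1K_2}\left(\frac{\Gamma(c)\Gamma(a+b-c+1)}{\Gamma(a)\Gamma(b)}\right)^2.$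 -/

import Mathlib

open Filter Topology Complex
open scoped ContDiff

namespace ConicalSphere

noncomputable section

/-! ### The Gaussian hypergeometric function on `ℂ \ [1, +∞)` -/

/-- The plane slit along `[1, +∞)`. -/
def cutPlane : Set ℂ := {z | 1 - z ∈ slitPlane}

/-- `f` is holomorphic on `ℂ \ [1, +∞)` and is given by the hypergeometric series
`∑ (a)ₙ (b)ₙ / (c)ₙ zⁿ / n!` on the unit disk. -/
def IsHypergeometricContinuation (a b c : ℂ) (f : ℂ → ℂ) : Prop :=
  DifferentiableOn ℂ f cutPlane ∧ ∀ z : ℂ, ‖z‖ < 1 → f z = ₂F₁ a b c z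

theorem isOpen_cutPlane : IsOpen cutPlane :=
  isOpen_slitPlane.preimage (continuous_const.sub continuous_id)

theorem ball_subset_cutPlane : Metric.ball (0 : ℂ) 1 ⊆ cutPlane := by
  intro z hz
  have hz' : ‖z‖ < 1 := by simpa using hz
  refine Or.inl ?_
  have := (Complex.re_le_norm z).trans_lt hz'
  simpa using this

theorem isPreconnected_cutPlane : IsPreconnected cutPlane := by
  have h : cutPlane = (fun w : ℂ => 1 - w) '' slitPlane := by
    ext z
    constructor
    · intro hz
      exact ⟨1 - z, hz, by simp⟩
    · rintro ⟨w, hw, rfl⟩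
      simpa [cutPlane] using hw
  rw [h]
  exact (starConvex_one_slitPlane.isPathConnected one_mem_slitPlane).isConnected.isPreconnected.image _
    (continuous_const.sub continuous_id).continuousOn

/-- The analytic continuation is unique on the slit plane. -/
theorem IsHypergeometricContinuation.eqOn {a b c : ℂ} {f g : ℂ → ℂ}
    (hf : IsHypergeometricContinuation a b c f) (hg : IsHypergeometricContinuation a b c g) :
    Set.EqOn f g cutPlane := by
  refine (hf.1.analyticOnNhd isOpen_cutPlane).eqOn_of_preconnected_of_eventuallyEq
    (hg.1.analyticOnNhd isOpen_cutPlane) isPreconnected_cutPlane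
    (ball_subset_cutPlane (Metric.mem_ball_self one_pos)) ?_
  filter_upwards [Metric.ball_mem_nhds (0 : ℂ) one_pos] with z hz
  have hz' : ‖z‖ < 1 := by simpa using hz
  rw [hf.2 z hz', hg.2 z hz']

open Classical in
/-- The Gaussian hypergeometric function `F(a,b,c;z)`: the hypergeometric series, continued
analytically to `ℂ \ [1, +∞)` (only its values there are used below). -/
def hypF (a b c z : ℂ) : ℂ :=
  if h : ∃ f : ℂ → ℂ, IsHypergeometricContinuation a b c f then h.choose z else 0

/-- `hypF` agrees on the slit plane with any analytic continuation of the series. -/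
theorem hypF_eqOn {a b c : ℂ} {f : ℂ → ℂ} (hf : IsHypergeometricContinuation a b c f) :
    Set.EqOn (hypF a b c) f cutPlane := by
  have h : ∃ f : ℂ → ℂ, IsHypergeometricContinuation a b c f := ⟨f, hf⟩
  intro z hz
  rw [hypF, dif_pos h]
  exact h.choose_spec.eqOn hf hz

/-! ### The density with three conical singularities -/

/-- `a = (α + β - γ) / 2` -/
def parA (α β γ : ℝ) : ℝ := (α + β - γ) / 2

/-- `b = (α + β + γ - 2) / 2` -/
def parB (α β γ : ℝ) : ℝ := (α + β + γ - 2) / 2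

/-- `K₁ = -Γ(c-a) Γ(c-b) / (Γ(c) Γ(c-a-b))` -/
def K₁ (a b c : ℝ) : ℝ :=
  -(Real.Gamma (c - a) * Real.Gamma (c - b)) / (Real.Gamma c * Real.Gamma (c - a - b))

/-- `K₂ = -Γ(a+1-c) Γ(b+1-c) / (Γ(1-c) Γ(a+b+1-c))` -/
def K₂ (a b c : ℝ) : ℝ :=
  -(Real.Gamma (a + 1 - c) * Real.Gamma (b + 1 - c)) /
    (Real.Gamma (1 - c) * Real.Gamma (a + b + 1 - c))

/-- `K₃ = √(sin πa sin πb / (sin π(c-a) sin π(c-b))) · Γ(a+b+1-c) Γ(c) / (Γ(a) Γ(b))` -/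
def K₃ (a b c : ℝ) : ℝ :=
  Real.sqrt (Real.sin (Real.pi * a) * Real.sin (Real.pi * b) /
      (Real.sin (Real.pi * (c - a)) * Real.sin (Real.pi * (c - b)))) *
    (Real.Gamma (a + b + 1 - c) * Real.Gamma c / (Real.Gamma a * Real.Gamma b))

/-- `φ₁(z) = F(a,b,c;z)`, holomorphic on `ℂ \ [1, +∞)` -/
def φ₁ (a b c : ℝ) (z : ℂ) : ℂ := hypF a b c z

/-- `φ₂(z) = F(a,b,a+b-c+1;1-z)`, holomorphic on `ℂ \ (-∞, 0]` -/
def φ₂ (a b c : ℝ) (z : ℂ) : ℂ := hypF a b ((a + b - c + 1 : ℝ) : ℂ) (1 - z)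

/-- `ℂ \ ((-∞, 0] ∪ [1, +∞))`, the set on which both `φ₁` and `φ₂` are holomorphic. -/
def slitDomain : Set ℂ := {z | z ∈ slitPlane ∧ 1 - z ∈ slitPlane}

/-- The explicit formula for the density off the slits, with `c = α`. -/
def densityFormula (α β γ : ℝ) (z : ℂ) : ℝ :=
  let a := parA α β γ
  let b := parB α β γ
  1 / (‖z‖ ^ α * ‖1 - z‖ ^ β) *
    (K₃ a b α / (K₁ a b α * ‖φ₁ a b α z‖ ^ 2 + K₂ a b α * ‖φ₂ a b α z‖ ^ 2 +
      2 * (φ₁ a b α z * φ₂ a b α (starRingEnd ℂ z)).re))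

/-- The generalized hyperbolic density `λ_{α,β,γ}` on `ℂ \ {0, 1}`: the explicit formula,
extended continuously across the two slits (`extendFrom A f x` is the limit of `f` at `x`
within `A`). -/
def density (α β γ : ℝ) : ℂ → ℝ := extendFrom slitDomain (densityFormula α β γ)

/-- `u = log λ_{α,β,γ}` -/
def logDensity (α β γ : ℝ) (z : ℂ) : ℝ := Real.log (density α β γ z)

/-! ### Wirtinger derivatives -/

/-- `∂f = (∂f/∂x - i ∂f/∂y) / 2` -/
def wirtinger (f : ℂ → ℂ) (z : ℂ) : ℂ := (fderiv ℝ f z 1 - I * fderiv ℝ f z I) / 2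

/-- `∂̄f = (∂f/∂x + i ∂f/∂y) / 2` -/
def wirtingerBar (f : ℂ → ℂ) (z : ℂ) : ℂ := (fderiv ℝ f z 1 + I * fderiv ℝ f z I) / 2

end

end ConicalSphere

open ConicalSphere

namespace ConicalSphere

/-! ### The hypergeometric series and its differential equation on the unit disk -/

theorem hasFPowerSeriesOnBall_deriv_ofScalars {f : ℂ → ℂ} {q : ℕ → ℂ} {r : ENNReal}
    (h : HasFPowerSeriesOnBall f (FormalMultilinearSeries.ofScalars ℂ q) 0 r) :
    HasFPowerSeriesOnBall (deriv f)
      (FormalMultilinearSeries.ofScalars ℂ fun n => (n + 1) * q (n + 1)) 0 r := by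
  have h1 := (ContinuousLinearMap.apply ℂ ℂ (1 : ℂ)).comp_hasFPowerSeriesOnBall h.fderiv
  have h2 : ((ContinuousLinearMap.apply ℂ ℂ (1 : ℂ)) ∘ fderiv ℂ f) = deriv f := by
    ext z
    simp
  rw [h2] at h1
  convert h1 using 1
  refine FormalMultilinearSeries.ext fun n => ?_
  refine ContinuousMultilinearMap.ext_ring ?_
  have h3 := FormalMultilinearSeries.derivSeries_coeff_one
    (FormalMultilinearSeries.ofScalars ℂ q) n
  simp only [FormalMultilinearSeries.coeff, Pi.one_def] at h3
  simp only [ContinuousLinearMap.compFormalMultilinearSeries_apply',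
    ContinuousLinearMap.apply_apply, h3]
  simp

theorem hasSum_of_hasFPowerSeriesOnBall_ofScalars {f : ℂ → ℂ} {q : ℕ → ℂ}
    (h : HasFPowerSeriesOnBall f (FormalMultilinearSeries.ofScalars ℂ q) 0 1) {z : ℂ}
    (hz : ‖z‖ < 1) : HasSum (fun n => q n * z ^ n) (f z) := by
  have h1 := h.hasSum (y := z) (by
    rw [Metric.mem_eball, edist_zero_right, ← ofReal_norm, ENNReal.ofReal_lt_one]
    exact hz)
  simpa [FormalMultilinearSeries.ofScalars_apply_eq, mul_comm] using h1

theorem hasFPowerSeriesOnBall_hypergeometric {a b c : ℂ}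
    (habc : ∀ k : ℕ, (k : ℂ) ≠ -a ∧ (k : ℂ) ≠ -b ∧ (k : ℂ) ≠ -c) :
    HasFPowerSeriesOnBall (₂F₁ a b c : ℂ → ℂ)
      (FormalMultilinearSeries.ofScalars ℂ (ordinaryHypergeometricCoefficient a b c)) 0 1 := by
  have h := (ordinaryHypergeometricSeries ℂ a b c).hasFPowerSeriesOnBall (by
    rw [ordinaryHypergeometricSeries_radius_eq_one ℂ a b c habc]; exact one_pos)
  rwa [ordinaryHypergeometricSeries_radius_eq_one ℂ a b c habc] at h

theorem ordinaryHypergeometricCoefficient_succ {a b c : ℂ} (hc : ∀ k : ℕ, (k : ℂ) ≠ -c) (n : ℕ) :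
    (n + 1) * (c + n) * ordinaryHypergeometricCoefficient a b c (n + 1) =
      (a + n) * (b + n) * ordinaryHypergeometricCoefficient a b c n := by
  have h1 : c + n ≠ 0 := fun h => hc n (by linear_combination h)
  have h2 : (n + 1 : ℂ) ≠ 0 := by exact_mod_cast n.succ_ne_zero
  have h3 : (n.factorial : ℂ) ≠ 0 := by exact_mod_cast n.factorial_ne_zero
  simp only [ordinaryHypergeometricCoefficient, ascPochhammer_succ_eval, Nat.factorial_succ,
    Nat.cast_mul, Nat.cast_add, Nat.cast_one, mul_inv]
  field_simp

/-- The hypergeometric differential equation on the unit disk. -/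
theorem hypergeometric_ode {a b c : ℂ}
    (habc : ∀ k : ℕ, (k : ℂ) ≠ -a ∧ (k : ℂ) ≠ -b ∧ (k : ℂ) ≠ -c) {z : ℂ} (hz : ‖z‖ < 1) :
    z * (1 - z) * deriv (deriv (₂F₁ a b c)) z + (c - (a + b + 1) * z) * deriv (₂F₁ a b c) z -
      a * b * ₂F₁ a b c z = 0 := by
  have h0 := hasFPowerSeriesOnBall_hypergeometric habc
  have hrec := ordinaryHypergeometricCoefficient_succ (a := a) (b := b) fun k => (habc k).2.2
  generalize ordinaryHypergeometricCoefficient a b c = q at h0 hrec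
  have h1 := hasFPowerSeriesOnBall_deriv_ofScalars h0
  have h2 := hasFPowerSeriesOnBall_deriv_ofScalars h1
  have s0 := hasSum_of_hasFPowerSeriesOnBall_ofScalars h0 hz
  have s1 := hasSum_of_hasFPowerSeriesOnBall_ofScalars h1 hz
  have s2 := hasSum_of_hasFPowerSeriesOnBall_ofScalars h2 hz
  have t1 : HasSum (fun n : ℕ => n * q n * z ^ n) (z * deriv (₂F₁ a b c) z) := by
    rw [← hasSum_nat_add_iff' 1]
    simpa [pow_succ, mul_assoc, mul_comm, mul_left_comm] using s1.mul_left z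
  have t2 : HasSum (fun n : ℕ => n * ((n + 1) * q (n + 1)) * z ^ n)
      (z * deriv (deriv (₂F₁ a b c)) z) := by
    rw [← hasSum_nat_add_iff' 1]
    simpa [pow_succ, mul_assoc, mul_comm, mul_left_comm] using s2.mul_left z
  have t3 : HasSum (fun n : ℕ => n * (n - 1) * q n * z ^ n)
      (z * (z * deriv (deriv (₂F₁ a b c)) z)) := by
    rw [← hasSum_nat_add_iff' 1]
    simpa [pow_succ, mul_assoc, mul_comm, mul_left_comm] using t2.mul_left z
  have hs := ((t2.sub t3).add ((s1.mul_left c).sub (t1.mul_left (a + b + 1)))).sub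
    (s0.mul_left (a * b))
  have hzero : (fun n : ℕ => n * ((n + 1) * q (n + 1)) * z ^ n - n * (n - 1) * q n * z ^ n +
      (c * ((n + 1) * q (n + 1) * z ^ n) - (a + b + 1) * (n * q n * z ^ n)) -
      a * b * (q n * z ^ n)) = fun _ => 0 := by
    funext n
    linear_combination z ^ n * hrec n
  have h := (hs.congr_fun fun n => (congrFun hzero n).symm).unique hasSum_zero
  linear_combination h

theorem natCast_ne_neg_ofReal {x : ℝ} (hx : 0 < x) (k : ℕ) : (k : ℂ) ≠ -(x : ℂ) := by
  intro h
  have : (k : ℝ) = -x := by exact_mod_cast h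
  have := k.cast_nonneg (α := ℝ)
  linarith

theorem natCast_ne_neg_params {a b c : ℝ} (ha : 0 < a) (hb : 0 < b) (hc : 0 < c) (k : ℕ) :
    (k : ℂ) ≠ -(a : ℂ) ∧ (k : ℂ) ≠ -(b : ℂ) ∧ (k : ℂ) ≠ -(c : ℂ) :=
  ⟨natCast_ne_neg_ofReal ha k, natCast_ne_neg_ofReal hb k, natCast_ne_neg_ofReal hc k⟩

theorem analyticAt_hypergeometric {a b c : ℂ}
    (habc : ∀ k : ℕ, (k : ℂ) ≠ -a ∧ (k : ℂ) ≠ -b ∧ (k : ℂ) ≠ -c) {z : ℂ} (hz : ‖z‖ < 1) :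
    AnalyticAt ℂ (₂F₁ a b c) z :=
  (hasFPowerSeriesOnBall_hypergeometric habc).analyticAt_of_mem (by
    rw [Metric.mem_eball, edist_zero_right, ← ofReal_norm, ENNReal.ofReal_lt_one]
    exact hz)

/-- The binomial series, written with rising factorials. -/
theorem hasSum_one_sub_cpow_neg (a : ℂ) {w : ℂ} (hw : ‖w‖ < 1) :
    HasSum (fun n : ℕ => (n.factorial : ℂ)⁻¹ * (ascPochhammer ℂ n).eval a * w ^ n)
      ((1 - w) ^ (-a)) := by
  have h := (one_add_cpow_hasFPowerSeriesOnBall_zero (a := -a)).hasSum (y := -w) (by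
    rw [Metric.mem_eball, edist_zero_right, ← ofReal_norm, ENNReal.ofReal_lt_one]
    simpa using hw)
  rw [binomialSeries_eq_ordinaryHypergeometricSeries (b := (1 : ℂ))
    (fun k => by simpa using natCast_ne_neg_ofReal one_pos k)] at h
  rw [zero_add, ← sub_eq_add_neg] at h
  refine h.congr_fun fun n => ?_
  rw [FormalMultilinearSeries.compContinuousLinearMap_apply]
  have : (ascPochhammer ℂ n).eval (1 : ℂ) ≠ 0 := by
    rw [ascPochhammer_eval_one]; exact_mod_cast n.factorial_ne_zero
  have hf : (⇑(-ContinuousLinearMap.id ℂ ℂ) ∘ fun _ : Fin n => -w) = fun _ => w := by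
    ext; simp
  rw [hf, ordinaryHypergeometricSeries_apply_eq, neg_neg, smul_eq_mul,
    mul_inv_cancel_right₀ this]

/-! ### Euler's integral -/

/-- The weight `t ^ (b - 1) * (1 - t) ^ (c - b - 1)` in Euler's integral. -/
noncomputable def eulerWeight (b c : ℂ) (t : ℝ) : ℂ :=
  (t : ℂ) ^ (b - 1) * (1 - (t : ℂ)) ^ (c - b - 1)

/-- Euler's integral `∫₀¹ t ^ (b - 1) * (1 - t) ^ (c - b - 1) * (1 - z * t) ^ (-a) dt`. -/
noncomputable def eulerIntegral (a b c z : ℂ) : ℂ :=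
  ∫ t : ℝ in 0..1, eulerWeight b c t * (1 - z * t) ^ (-a)

theorem intervalIntegrable_eulerWeight {b c : ℂ} (hb : 0 < b.re) (hbc : b.re < c.re) :
    IntervalIntegrable (eulerWeight b c) MeasureTheory.volume 0 1 :=
  betaIntegral_convergent hb (by simpa using hbc)

theorem one_sub_mul_mem_slitPlane {z : ℂ} (hz : z ∈ cutPlane) {t : ℝ} (ht : t ∈ Set.Icc (0 : ℝ) 1) :
    1 - z * t ∈ slitPlane := by
  have h := starConvex_one_slitPlane (show 1 - z ∈ slitPlane from hz) (sub_nonneg.2 ht.2) ht.1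
    (by ring)
  convert h using 1
  simp only [real_smul]
  push_cast
  ring

theorem continuousOn_one_sub_mul_cpow {z : ℂ} (hz : z ∈ cutPlane) (s : ℂ) :
    ContinuousOn (fun t : ℝ => (1 - z * t) ^ s) (Set.uIcc 0 1) := by
  rw [Set.uIcc_of_le zero_le_one]
  exact fun t ht => ((by fun_prop : ContinuousAt (fun t : ℝ => 1 - z * (t : ℂ)) t).cpow
    continuousAt_const (one_sub_mul_mem_slitPlane hz ht)).continuousWithinAt

theorem differentiableOn_eulerIntegral {a b c : ℂ} (hb : 0 < b.re) (hbc : b.re < c.re) :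
    DifferentiableOn ℂ (eulerIntegral a b c) cutPlane := by
  intro z hz
  have hw := intervalIntegrable_eulerWeight hb hbc
  obtain ⟨r, hr, hball⟩ := Metric.nhds_basis_closedBall.mem_iff.1 (isOpen_cutPlane.mem_nhds hz)
  have hcont : ContinuousOn (fun p : ℂ × ℝ => -a * (1 - p.1 * p.2) ^ (-a - 1) * (-(p.2 : ℂ)))
      (Metric.closedBall z r ×ˢ Set.Icc 0 1) := by
    rintro ⟨y, t⟩ ⟨hy, ht⟩
    have h1 : ContinuousAt (fun p : ℂ × ℝ => (1 - p.1 * p.2) ^ (-a - 1)) (y, t) :=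
      (by fun_prop : ContinuousAt (fun p : ℂ × ℝ => 1 - p.1 * (p.2 : ℂ)) (y, t)).cpow
        continuousAt_const (one_sub_mul_mem_slitPlane (hball hy) ht)
    exact ((continuousAt_const.mul h1).mul (by fun_prop)).continuousWithinAt
  obtain ⟨C, hC⟩ := ((isCompact_closedBall z r).prod isCompact_Icc).exists_bound_of_continuousOn hcont
  have hmeas : ∀ y ∈ cutPlane, IntervalIntegrable (fun t : ℝ => eulerWeight b c t *
      (1 - y * t) ^ (-a)) MeasureTheory.volume 0 1 := fun y hy =>
    hw.mul_continuousOn (continuousOn_one_sub_mul_cpow hy _)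
  have hderiv := intervalIntegral.hasDerivAt_integral_of_dominated_loc_of_deriv_le
    (μ := MeasureTheory.volume) (a := 0) (b := 1) (x₀ := z) (s := Metric.ball z r)
    (F := fun y (t : ℝ) => eulerWeight b c t * (1 - y * t) ^ (-a))
    (F' := fun y (t : ℝ) => eulerWeight b c t * (-a * (1 - y * t) ^ (-a - 1) * (-(t : ℂ))))
    (bound := fun t => ‖eulerWeight b c t‖ * C) (Metric.ball_mem_nhds z hr)
    (by
      filter_upwards [isOpen_cutPlane.mem_nhds hz] with y hy
      have := (hmeas y hy).aestronglyMeasurable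
      rwa [Set.uIoc_of_le zero_le_one])
    (hmeas z hz)
    (by
      rw [Set.uIoc_of_le zero_le_one]
      refine (hw.mul_continuousOn (f := eulerWeight b c) ?_).aestronglyMeasurable
      exact (continuousOn_const.mul (continuousOn_one_sub_mul_cpow hz _)).mul (by fun_prop))
    (by
      refine Eventually.of_forall fun t ht y hy => ?_
      rw [Set.uIoc_of_le zero_le_one] at ht
      rw [norm_mul]
      exact mul_le_mul_of_nonneg_left
        (hC (y, t) ⟨Metric.ball_subset_closedBall hy, Set.Ioc_subset_Icc_self ht⟩) (norm_nonneg _))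
    (hw.norm.mul_const C)
    (by
      refine Eventually.of_forall fun t ht y hy => ?_
      rw [Set.uIoc_of_le zero_le_one] at ht
      refine HasDerivAt.const_mul _ (HasDerivAt.cpow_const ?_ (one_sub_mul_mem_slitPlane
        (hball (Metric.ball_subset_closedBall hy)) (Set.Ioc_subset_Icc_self ht)))
      simpa using ((hasDerivAt_id y).mul_const (t : ℂ)).const_sub 1)
  exact hderiv.2.differentiableAt.differentiableWithinAt

theorem Gamma_add_natCast {x : ℂ} (hx : 0 < x.re) (n : ℕ) :
    Gamma (x + n) = (ascPochhammer ℂ n).eval x * Gamma x := by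
  induction n with
  | zero => simp
  | succ n ih =>
    have h : x + n ≠ 0 := fun h => by
      have := congrArg re h
      simp at this
      have := n.cast_nonneg (α := ℝ)
      linarith
    rw [Nat.cast_succ, ← add_assoc, Gamma_add_one _ h, ih, ascPochhammer_succ_eval]
    ring

theorem integral_eulerWeight {b c : ℂ} (hb : 0 < b.re) (hbc : b.re < c.re) :
    ∫ t : ℝ in 0..1, eulerWeight b c t = Gamma b * Gamma (c - b) / Gamma c := by
  have := betaIntegral_eq_Gamma_mul_div b (c - b) hb (by simpa using hbc)
  rwa [add_sub_cancel] at this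

theorem integral_eulerWeight_mul_pow {b c : ℂ} (hb : 0 < b.re) (hbc : b.re < c.re) (n : ℕ) :
    ∫ t : ℝ in 0..1, eulerWeight b c t * (t : ℂ) ^ n =
      (ascPochhammer ℂ n).eval b * ((ascPochhammer ℂ n).eval c)⁻¹ *
        (Gamma b * Gamma (c - b) / Gamma c) := by
  have h := integral_eulerWeight (b := b + n) (c := c + n)
    (by simpa using by positivity) (by simpa using hbc)
  rw [Gamma_add_natCast hb, Gamma_add_natCast (hb.trans hbc), add_sub_add_right_eq_sub] at h
  have h2 : ∫ t : ℝ in 0..1, eulerWeight b c t * (t : ℂ) ^ n =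
      ∫ t : ℝ in 0..1, eulerWeight (b + n) (c + n) t := by
    refine intervalIntegral.integral_congr_ae (Eventually.of_forall fun t ht => ?_)
    rw [Set.uIoc_of_le zero_le_one] at ht
    have ht0 : (t : ℂ) ≠ 0 := by exact_mod_cast ht.1.ne'
    simp only [eulerWeight]
    rw [add_sub_add_right_eq_sub, show b + n - 1 = b - 1 + n by ring, cpow_add _ _ ht0,
      cpow_natCast]
    ring
  rw [h2, h, div_eq_mul_inv, div_eq_mul_inv, mul_inv]
  ring

theorem eulerIntegral_eq {a b c : ℂ} (hb : 0 < b.re) (hbc : b.re < c.re) {z : ℂ} (hz : ‖z‖ < 1) :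
    eulerIntegral a b c z = Gamma b * Gamma (c - b) / Gamma c * ₂F₁ a b c z := by
  have hw := intervalIntegrable_eulerWeight hb hbc
  set q : ℕ → ℂ := fun n => (n.factorial : ℂ)⁻¹ * (ascPochhammer ℂ n).eval a with hq
  have hzt : ∀ t ∈ Set.uIoc (0 : ℝ) 1, ‖z * t‖ < 1 := fun t ht => by
    rw [Set.uIoc_of_le zero_le_one] at ht
    rw [norm_mul, norm_real, Real.norm_of_nonneg ht.1.le]
    nlinarith [norm_nonneg z, ht.1, ht.2]
  have hsum : Summable fun n => ‖q n * z ^ n‖ :=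
    summable_norm_iff.2 (hasSum_one_sub_cpow_neg a hz).summable
  have h := intervalIntegral.hasSum_integral_of_dominated_convergence
    (μ := MeasureTheory.volume) (a := 0) (b := 1)
    (F := fun n (t : ℝ) => eulerWeight b c t * (q n * (z * t) ^ n))
    (f := fun t : ℝ => eulerWeight b c t * (1 - z * t) ^ (-a))
    (fun n t => ‖eulerWeight b c t‖ * ‖q n * z ^ n‖)
    (fun n => by
      rw [Set.uIoc_of_le zero_le_one]
      refine (hw.mul_continuousOn (f := eulerWeight b c) ?_).aestronglyMeasurable
      fun_prop)
    (fun n => Eventually.of_forall fun t ht => by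
      rw [Set.uIoc_of_le zero_le_one] at ht
      rw [norm_mul]
      refine mul_le_mul_of_nonneg_left ?_ (norm_nonneg _)
      rw [mul_pow, ← mul_assoc, norm_mul (q n * z ^ n)]
      refine mul_le_of_le_one_right (norm_nonneg _) ?_
      rw [norm_pow, norm_real, Real.norm_of_nonneg ht.1.le]
      exact pow_le_one₀ ht.1.le ht.2)
    (Eventually.of_forall fun t _ => hsum.mul_left _)
    (by
      simp_rw [tsum_mul_left]
      exact hw.norm.mul_const _)
    (Eventually.of_forall fun t ht => (hasSum_one_sub_cpow_neg a (hzt t ht)).mul_left _)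
  have h2 : (fun n : ℕ => ∫ t : ℝ in 0..1, eulerWeight b c t * (q n * (z * t) ^ n)) =
      fun n => Gamma b * Gamma (c - b) / Gamma c *
        (((n.factorial : ℂ)⁻¹ * (ascPochhammer ℂ n).eval a * (ascPochhammer ℂ n).eval b *
          ((ascPochhammer ℂ n).eval c)⁻¹) • z ^ n) := by
    funext n
    have : ∀ t : ℝ, eulerWeight b c t * (q n * (z * t) ^ n) =
        q n * z ^ n * (eulerWeight b c t * (t : ℂ) ^ n) := fun t => by ring
    simp_rw [this]
    rw [intervalIntegral.integral_const_mul, integral_eulerWeight_mul_pow hb hbc, smul_eq_mul]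
    ring
  rw [h2] at h
  rw [ordinaryHypergeometric_eq_tsum, ← tsum_mul_left]
  exact h.tsum_eq.symm

/-- Euler's integral continues the hypergeometric series to the slit plane. -/
theorem isHypergeometricContinuation_hypF {a b c : ℂ} (hb : 0 < b.re) (hbc : b.re < c.re) :
    IsHypergeometricContinuation a b c (hypF a b c) := by
  have hne : Gamma b * Gamma (c - b) / Gamma c ≠ 0 :=
    div_ne_zero (mul_ne_zero (Gamma_ne_zero_of_re_pos hb)
      (Gamma_ne_zero_of_re_pos (by simpa using hbc))) (Gamma_ne_zero_of_re_pos (hb.trans hbc))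
  have h : IsHypergeometricContinuation a b c
      fun z => (Gamma b * Gamma (c - b) / Gamma c)⁻¹ * eulerIntegral a b c z := by
    refine ⟨(differentiableOn_eulerIntegral hb hbc).const_mul _, fun z hz => ?_⟩
    simp only [eulerIntegral_eq hb hbc hz, inv_mul_cancel_left₀ hne]
  refine ⟨h.1.congr fun z hz => hypF_eqOn h hz, fun z hz => ?_⟩
  rw [hypF_eqOn h (ball_subset_cutPlane (by simpa using hz)), h.2 z hz]

/-- Gauss's summation, as a limit along the real axis. -/
theorem tendsto_hypergeometric_one {a b c : ℝ} (ha : 0 ≤ a) (hb : 0 < b) (habc : a + b < c) :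
    Tendsto (fun x : ℝ => (₂F₁ (a : ℂ) (b : ℂ) (c : ℂ) (x : ℂ) : ℂ)) (𝓝[<] 1)
      (𝓝 ((Real.Gamma c * Real.Gamma (c - a - b) /
        (Real.Gamma (c - a) * Real.Gamma (c - b)) : ℝ) : ℂ)) := by
  have hb' : 0 < (b : ℂ).re := by simpa
  have hbc : (b : ℂ).re < (c : ℂ).re := by simp; linarith
  have hbca : (b : ℂ).re < ((c - a : ℝ) : ℂ).re := by simp; linarith
  have hlim : ∀ t : ℝ, t ∈ Set.Ioo (0 : ℝ) 1 →
      eulerWeight b c t * (1 - t : ℂ) ^ (-(a : ℂ)) = eulerWeight b (c - a : ℝ) t := by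
    intro t ht
    have : (1 - t : ℂ) ≠ 0 := by exact_mod_cast (sub_pos.2 ht.2).ne'
    rw [eulerWeight, eulerWeight, mul_assoc, ← cpow_add _ _ this]
    push_cast
    ring_nf
  have hne : ∀ᵐ t : ℝ, t ∈ Set.uIoc (0 : ℝ) 1 → t ∈ Set.Ioo (0 : ℝ) 1 := by
    filter_upwards [MeasureTheory.Measure.ae_ne MeasureTheory.volume (1 : ℝ)] with t ht1 ht
    rw [Set.uIoc_of_le zero_le_one] at ht
    exact ⟨ht.1, lt_of_le_of_ne ht.2 ht1⟩
  have hxcut : ∀ᶠ x : ℝ in 𝓝[<] 1, x ∈ Set.Ioo (0 : ℝ) 1 := Ioo_mem_nhdsLT one_pos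
  have h := intervalIntegral.tendsto_integral_filter_of_dominated_convergence
    (μ := MeasureTheory.volume) (a := 0) (b := 1) (l := 𝓝[<] (1 : ℝ))
    (F := fun (x : ℝ) (t : ℝ) => eulerWeight b c t * (1 - (x : ℂ) * t) ^ (-(a : ℂ)))
    (f := eulerWeight b (c - a : ℝ)) (fun t => ‖eulerWeight b (c - a : ℝ) t‖)
    (by
      filter_upwards [hxcut] with x hx
      have hxc : (x : ℂ) ∈ cutPlane := ball_subset_cutPlane (by
        rw [mem_ball_zero_iff, norm_real, Real.norm_of_nonneg hx.1.le]; exact hx.2)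
      rw [Set.uIoc_of_le zero_le_one]
      exact ((intervalIntegrable_eulerWeight hb' hbc).mul_continuousOn
        (continuousOn_one_sub_mul_cpow hxc _)).aestronglyMeasurable)
    (by
      filter_upwards [hxcut] with x hx
      filter_upwards [hne] with t ht ht'
      have ht := ht ht'
      rw [← hlim t ht, norm_mul, norm_mul]
      refine mul_le_mul_of_nonneg_left ?_ (norm_nonneg _)
      have h1 : 0 < 1 - t := sub_pos.2 ht.2
      have h2 : 1 - t ≤ 1 - x * t := by nlinarith [hx.1, hx.2, ht.1]
      have e1 : (1 - (x : ℂ) * t) = ((1 - x * t : ℝ) : ℂ) := by push_cast; ring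
      have e2 : (1 - (t : ℂ)) = ((1 - t : ℝ) : ℂ) := by push_cast; ring
      rw [e1, e2, norm_cpow_eq_rpow_re_of_pos (h1.trans_le h2), norm_cpow_eq_rpow_re_of_pos h1]
      exact Real.rpow_le_rpow_of_nonpos h1 h2 (by simpa using ha))
    (intervalIntegrable_eulerWeight hb' hbca).norm
    (by
      filter_upwards [hne] with t ht ht'
      have ht := ht ht'
      rw [← hlim t ht]
      refine Tendsto.mono_left ?_ nhdsWithin_le_nhds
      refine tendsto_const_nhds.mul ?_
      have hc : ContinuousAt (fun x : ℝ => (1 - (x : ℂ) * t) ^ (-(a : ℂ))) 1 := by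
        refine (by fun_prop : ContinuousAt (fun x : ℝ => 1 - (x : ℂ) * t) 1).cpow
          continuousAt_const ?_
        refine Or.inl ?_
        simpa using ht.2
      simpa using hc.tendsto)
  rw [integral_eulerWeight hb' hbca] at h
  have hG : (Gamma b * Gamma (c - b) / Gamma c : ℂ) ≠ 0 :=
    div_ne_zero (mul_ne_zero (Gamma_ne_zero_of_re_pos hb')
      (Gamma_ne_zero_of_re_pos (by simpa using hbc))) (Gamma_ne_zero_of_re_pos (hb'.trans hbc))
  have h2 := h.const_mul (Gamma b * Gamma (c - b) / Gamma c : ℂ)⁻¹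
  refine (h2.congr' ?_).trans_eq ?_
  · filter_upwards [hxcut] with x hx
    have hx1 : ‖(x : ℂ)‖ < 1 := by
      rw [norm_real, Real.norm_of_nonneg hx.1.le]; exact hx.2
    rw [← eulerIntegral, eulerIntegral_eq hb' hbc hx1, inv_mul_cancel_left₀ hG]
  · have g1 : (Real.Gamma b : ℂ) ≠ 0 := by exact_mod_cast (Real.Gamma_pos_of_pos hb).ne'
    rw [← ofReal_sub, ← ofReal_sub, Gamma_ofReal, Gamma_ofReal, Gamma_ofReal, Gamma_ofReal,
      Gamma_ofReal]
    push_cast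
    congr 1
    field_simp

/-! ### The connection formula -/

/-- On `U`, `f` has derivative `f'` and solves the hypergeometric equation with
parameters `a, b, c`. -/
def SolvesHypergeometric (a b c : ℂ) (U : Set ℂ) (f f' : ℂ → ℂ) : Prop :=
  ∀ z ∈ U, HasDerivAt f (f' z) z ∧ ∃ d, HasDerivAt f' d z ∧
    z * (1 - z) * d + (c - (a + b + 1) * z) * f' z - a * b * f z = 0

/-- The intersection of the unit disks around `0` and `1`. -/
def lens : Set ℂ := Metric.ball 0 1 ∩ Metric.ball 1 1

theorem isOpen_lens : IsOpen lens := Metric.isOpen_ball.inter Metric.isOpen_ball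

theorem convex_lens : Convex ℝ lens := (convex_ball _ _).inter (convex_ball _ _)

theorem norm_lt_one_of_mem_lens {z : ℂ} (hz : z ∈ lens) : ‖z‖ < 1 := by simpa using hz.1

theorem norm_one_sub_lt_one_of_mem_lens {z : ℂ} (hz : z ∈ lens) : ‖1 - z‖ < 1 := by
  rw [norm_sub_rev, ← dist_eq_norm]
  exact hz.2

theorem mem_slitPlane_of_mem_lens {z : ℂ} (hz : z ∈ lens) : z ∈ slitPlane :=
  ball_one_subset_slitPlane hz.2

theorem one_sub_mem_slitPlane {z : ℂ} (hz : ‖z‖ < 1) : 1 - z ∈ slitPlane :=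
  ball_subset_cutPlane (by simpa using hz)

theorem ofReal_mem_lens {x : ℝ} (hx : x ∈ Set.Ioo (0 : ℝ) 1) : (x : ℂ) ∈ lens := by
  constructor
  · rw [mem_ball_zero_iff, norm_real, Real.norm_of_nonneg hx.1.le]
    exact hx.2
  · rw [Metric.mem_ball, dist_eq_norm, ← ofReal_one, ← ofReal_sub, norm_real, Real.norm_eq_abs,
      abs_lt]
    constructor <;> linarith [hx.1, hx.2]

theorem hasDerivAt_hypergeometricWeight {c e z : ℂ} (hz : z ∈ slitPlane) (hz' : 1 - z ∈ slitPlane) :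
    HasDerivAt (fun z : ℂ => z ^ c * (1 - z) ^ e)
      ((c * (1 - z) - e * z) / (z * (1 - z)) * (z ^ c * (1 - z) ^ e)) z := by
  have h0 := slitPlane_ne_zero hz
  have h1 := slitPlane_ne_zero hz'
  have h := ((hasDerivAt_id z).cpow_const (c := c) hz).mul
    (((hasDerivAt_id z).const_sub 1).cpow_const (c := e) hz')
  refine h.congr_deriv ?_
  simp only [id, cpow_sub _ _ h0, cpow_sub _ _ h1, cpow_one]
  field_simp
  ring

/-- Abel's identity for the hypergeometric equation. -/
theorem exists_wronskian_eq {a b c : ℂ} {f f' g g' : ℂ → ℂ}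
    (hf : SolvesHypergeometric a b c lens f f') (hg : SolvesHypergeometric a b c lens g g') :
    ∃ k, ∀ z ∈ lens, z ^ c * (1 - z) ^ (a + b + 1 - c) * (f z * g' z - f' z * g z) = k := by
  have hd : ∀ z ∈ lens, HasDerivAt
      (fun z : ℂ => z ^ c * (1 - z) ^ (a + b + 1 - c) * (f z * g' z - f' z * g z)) 0 z := by
    intro z hz
    obtain ⟨hf1, df, hf2, hfe⟩ := hf z hz
    obtain ⟨hg1, dg, hg2, hge⟩ := hg z hz
    have hs := mem_slitPlane_of_mem_lens hz
    have hs' := one_sub_mem_slitPlane (norm_lt_one_of_mem_lens hz)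
    have h0 := slitPlane_ne_zero hs
    have h1 := slitPlane_ne_zero hs'
    refine ((hasDerivAt_hypergeometricWeight (c := c) (e := a + b + 1 - c) hs hs').mul
      ((hf1.mul hg2).sub (hf2.mul hg1))).congr_deriv ?_
    simp only [Pi.mul_apply, Pi.sub_apply]
    generalize z ^ c * (1 - z) ^ (a + b + 1 - c) = p
    field_simp
    linear_combination p * f z * hge - p * g z * hfe
  have hhalf : ((1 / 2 : ℝ) : ℂ) ∈ lens := ofReal_mem_lens (by norm_num)
  refine ⟨_, fun z hz => isOpen_lens.is_const_of_deriv_eq_zero convex_lens.isPreconnected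
    (fun y hy => (hd y hy).differentiableAt.differentiableWithinAt)
    (fun y hy => (hd y hy).deriv) hz hhalf⟩

theorem solvesHypergeometric_series {a b c : ℂ}
    (habc : ∀ k : ℕ, (k : ℂ) ≠ -a ∧ (k : ℂ) ≠ -b ∧ (k : ℂ) ≠ -c) :
    SolvesHypergeometric a b c lens (₂F₁ a b c) (deriv (₂F₁ a b c)) := by
  intro z hz
  have hz := norm_lt_one_of_mem_lens hz
  have h := analyticAt_hypergeometric habc hz
  exact ⟨h.differentiableAt.hasDerivAt, _, h.deriv.differentiableAt.hasDerivAt,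
    hypergeometric_ode habc hz⟩

theorem solvesHypergeometric_one_sub {a b c : ℂ}
    (habc : ∀ k : ℕ, (k : ℂ) ≠ -a ∧ (k : ℂ) ≠ -b ∧ (k : ℂ) ≠ -(a + b + 1 - c)) :
    SolvesHypergeometric a b c lens (fun z => ₂F₁ a b (a + b + 1 - c) (1 - z))
      (fun z => -deriv (₂F₁ a b (a + b + 1 - c)) (1 - z)) := by
  intro z hz
  have hz := norm_one_sub_lt_one_of_mem_lens hz
  have h := analyticAt_hypergeometric habc hz
  refine ⟨h.differentiableAt.hasDerivAt.comp_const_sub 1 z, _,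
    (h.deriv.differentiableAt.hasDerivAt.comp_const_sub 1 z).neg, ?_⟩
  have := hypergeometric_ode habc hz
  linear_combination this

theorem solvesHypergeometric_cpow_mul {a b c : ℂ}
    (habc : ∀ k : ℕ, (k : ℂ) ≠ -(a + 1 - c) ∧ (k : ℂ) ≠ -(b + 1 - c) ∧ (k : ℂ) ≠ -(2 - c)) :
    SolvesHypergeometric a b c lens
      (fun z => z ^ (1 - c) * ₂F₁ (a + 1 - c) (b + 1 - c) (2 - c) z)
      (fun z => z ^ (-c) * ((1 - c) * ₂F₁ (a + 1 - c) (b + 1 - c) (2 - c) z +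
        z * deriv (₂F₁ (a + 1 - c) (b + 1 - c) (2 - c)) z)) := by
  intro z hz
  have hs := mem_slitPlane_of_mem_lens hz
  have h0 := slitPlane_ne_zero hs
  have hz := norm_lt_one_of_mem_lens hz
  have h := analyticAt_hypergeometric habc hz
  have h1 := h.differentiableAt.hasDerivAt
  have h2 := h.deriv.differentiableAt.hasDerivAt
  have hode := hypergeometric_ode habc hz
  generalize (₂F₁ (a + 1 - c) (b + 1 - c) (2 - c) : ℂ → ℂ) = G at h1 h2 hode ⊢
  have hp : ∀ s : ℂ, HasDerivAt (fun z : ℂ => z ^ s) (s * z ^ (s - 1)) z := fun s => by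
    simpa using (hasDerivAt_id z).cpow_const (c := s) hs
  refine ⟨?_, _, (hp (-c)).mul ((h1.const_mul (1 - c)).add ((hasDerivAt_id z).mul h2)), ?_⟩
  · refine ((hp (1 - c)).mul h1).congr_deriv ?_
    rw [show 1 - c - 1 = -c by ring, show 1 - c = -c + 1 by ring, cpow_add _ _ h0, cpow_one]
    ring
  · simp only [id]
    rw [show 1 - c = -c + 1 by ring, cpow_add _ _ h0, cpow_sub _ _ h0, cpow_one]
    generalize z ^ (-c) = p
    field_simp
    linear_combination p * z * hode

theorem exists_linear_combination_on_lens {a b c : ℝ} (ha : 0 < a) (hb : 0 < b) (habc : a + b < c)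
    (hc : c < 1) : ∃ A B : ℂ, ∀ z ∈ lens,
      (₂F₁ (a : ℂ) (b : ℂ) (a + b + 1 - c : ℂ) (1 - z) : ℂ) = A * ₂F₁ (a : ℂ) (b : ℂ) (c : ℂ) z +
        B * (z ^ (1 - c : ℂ) * ₂F₁ (a + 1 - c : ℂ) (b + 1 - c : ℂ) (2 - c : ℂ) z) := by
  have n1 := natCast_ne_neg_params ha hb (show 0 < c by linarith)
  have n2 := natCast_ne_neg_params ha hb (show 0 < a + b + 1 - c by linarith)
  push_cast at n2
  have n3 := natCast_ne_neg_params (show 0 < a + 1 - c by linarith)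
    (show 0 < b + 1 - c by linarith) (show 0 < 2 - c by linarith)
  push_cast at n3
  obtain ⟨k0, h0⟩ := exists_wronskian_eq (solvesHypergeometric_series n1)
    (solvesHypergeometric_cpow_mul n3)
  obtain ⟨k1, h1⟩ := exists_wronskian_eq (solvesHypergeometric_one_sub n2)
    (solvesHypergeometric_cpow_mul n3)
  obtain ⟨k2, h2⟩ := exists_wronskian_eq (solvesHypergeometric_series n1)
    (solvesHypergeometric_one_sub n2)
  have an1 := analyticAt_hypergeometric n1 (z := 0) (by simp)
  have an3 := analyticAt_hypergeometric n3 (z := 0) (by simp)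
  have v1 : ₂F₁ (a : ℂ) (b : ℂ) (c : ℂ) (0 : ℂ) = 1 := ordinaryHypergeometric_zero _ _ _
  have v3 : ₂F₁ (a + 1 - c : ℂ) (b + 1 - c : ℂ) (2 - c : ℂ) (0 : ℂ) = 1 :=
    ordinaryHypergeometric_zero _ _ _
  generalize (₂F₁ (a + 1 - c : ℂ) (b + 1 - c : ℂ) (2 - c : ℂ) : ℂ → ℂ) = G at *
  generalize (₂F₁ (a : ℂ) (b : ℂ) (c : ℂ) : ℂ → ℂ) = F at *
  have hk0 : k0 = 1 - c := by
    have hcont : ContinuousAt (fun z : ℂ => (1 - z) ^ (a + b + 1 - c : ℂ) *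
        (F z * ((1 - c) * G z + z * deriv G z) - z * deriv F z * G z)) 0 := by
      have := an1.continuousAt
      have := an3.continuousAt
      have := an1.deriv.continuousAt
      have := an3.deriv.continuousAt
      refine ContinuousAt.mul ?_ (by fun_prop)
      exact (by fun_prop : ContinuousAt (fun z : ℂ => 1 - z) 0).cpow continuousAt_const
        (by simp)
    have ht : Tendsto (fun x : ℝ => (x : ℂ)) (𝓝[>] 0) (𝓝 0) :=
      (by simpa using continuous_ofReal.tendsto 0 : Tendsto (fun x : ℝ => (x : ℂ)) (𝓝 0) (𝓝 0))
        |>.mono_left nhdsWithin_le_nhds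
    have hlim := hcont.tendsto.comp ht
    have hval : (1 - 0 : ℂ) ^ (a + b + 1 - c : ℂ) *
        (F 0 * ((1 - c) * G 0 + 0 * deriv G 0) - 0 * deriv F 0 * G 0) = 1 - c := by
      simp [v1, v3]
    rw [hval] at hlim
    refine tendsto_nhds_unique (tendsto_const_nhds.congr' ?_) hlim
    filter_upwards [Ioo_mem_nhdsGT one_pos] with x hx
    have hx' := ofReal_mem_lens hx
    have hx0 := slitPlane_ne_zero (mem_slitPlane_of_mem_lens hx')
    rw [← h0 _ hx', Function.comp_apply, cpow_sub _ _ hx0, cpow_one, cpow_neg]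
    have : (x : ℂ) ^ (c : ℂ) ≠ 0 := by simp [cpow_eq_zero_iff, hx0]
    field_simp
  have hk0' : k0 ≠ 0 := by
    rw [hk0]
    exact_mod_cast (sub_pos.2 hc).ne'
  refine ⟨k1 / k0, k2 / k0, fun z hz => ?_⟩
  have e0 := h0 z hz
  have e1 := h1 z hz
  have e2 := h2 z hz
  field_simp
  rw [← e0, ← e1, ← e2]
  ring

theorem connection_on_lens {a b c : ℝ} (ha : 0 < a) (hb : 0 < b) (habc : a + b < c)
    (hc : c < 1) {A B : ℝ}
    (hA : A = Real.Gamma (a + b + 1 - c) * Real.Gamma (1 - c) /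
      (Real.Gamma (b + 1 - c) * Real.Gamma (a + 1 - c)))
    (hB : A * (Real.Gamma c * Real.Gamma (c - a - b) / (Real.Gamma (c - a) * Real.Gamma (c - b))) +
      B * (Real.Gamma (2 - c) * Real.Gamma (c - a - b) /
        (Real.Gamma (1 - a) * Real.Gamma (1 - b))) = 1) {z : ℂ} (hz : z ∈ lens) :
      (₂F₁ (a : ℂ) (b : ℂ) (a + b + 1 - c : ℂ) (1 - z) : ℂ) = A * ₂F₁ (a : ℂ) (b : ℂ) (c : ℂ) z +
        B * (z ^ (1 - c : ℂ) * ₂F₁ (a + 1 - c : ℂ) (b + 1 - c : ℂ) (2 - c : ℂ) z) := by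
  obtain ⟨A', B', h⟩ := exists_linear_combination_on_lens ha hb habc hc
  have n1 := natCast_ne_neg_params ha hb (show 0 < c by linarith)
  have n2 := natCast_ne_neg_params ha hb (show 0 < a + b + 1 - c by linarith)
  push_cast at n2
  have n3 := natCast_ne_neg_params (show 0 < a + 1 - c by linarith)
    (show 0 < b + 1 - c by linarith) (show 0 < 2 - c by linarith)
  push_cast at n3
  have t1 := tendsto_hypergeometric_one (a := a) (b := b) (c := c) ha.le hb habc
  have t2 := tendsto_hypergeometric_one (a := a) (b := b) (c := a + b + 1 - c) ha.le hb
    (by linarith)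
  have t3 := tendsto_hypergeometric_one (a := a + 1 - c) (b := b + 1 - c) (c := 2 - c)
    (by linarith) (by linarith) (by linarith)
  rw [show a + b + 1 - c - a - b = 1 - c by ring, show a + b + 1 - c - a = b + 1 - c by ring,
    show a + b + 1 - c - b = a + 1 - c by ring, ← hA] at t2
  rw [show 2 - c - (a + 1 - c) - (b + 1 - c) = c - a - b by ring,
    show 2 - c - (a + 1 - c) = 1 - a by ring, show 2 - c - (b + 1 - c) = 1 - b by ring] at t3
  push_cast at t2 t3
  have an1 := (analyticAt_hypergeometric n1 (z := 0) (by simp)).continuousAt.tendsto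
  have an2 := (analyticAt_hypergeometric n2 (z := 0) (by simp)).continuousAt.tendsto
  have an3 := (analyticAt_hypergeometric n3 (z := 0) (by simp)).continuousAt.tendsto
  rw [ordinaryHypergeometric_zero] at an1 an2 an3
  have hx0 : Tendsto (fun x : ℝ => (x : ℂ)) (𝓝[>] 0) (𝓝 0) :=
    (by simpa using continuous_ofReal.tendsto 0 : Tendsto (fun x : ℝ => (x : ℂ)) (𝓝 0) (𝓝 0))
      |>.mono_left nhdsWithin_le_nhds
  have hx1 : Tendsto (fun x : ℝ => (x : ℂ)) (𝓝[<] 1) (𝓝 1) :=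
    (by simpa using continuous_ofReal.tendsto 1 : Tendsto (fun x : ℝ => (x : ℂ)) (𝓝 1) (𝓝 1))
      |>.mono_left nhdsWithin_le_nhds
  have hsub : Tendsto (fun x : ℝ => 1 - x) (𝓝[>] 0) (𝓝[<] 1) := by
    refine tendsto_nhdsWithin_iff.2 ⟨?_, ?_⟩
    · exact ((by fun_prop : Continuous fun x : ℝ => 1 - x).tendsto' 0 1 (by simp)).mono_left
        nhdsWithin_le_nhds
    · filter_upwards [self_mem_nhdsWithin] with x hx
      simpa using hx
  have hA' : A' = A := by
    have hp : Tendsto (fun x : ℝ => (x : ℂ) ^ (1 - c : ℂ)) (𝓝[>] 0) (𝓝 0) := by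
      have : ContinuousAt (fun x : ℂ => x ^ (1 - c : ℂ)) 0 :=
        continuousAt_cpow_const_of_re_pos (by simp) (by simpa using hc)
      have h2 := this.tendsto.comp hx0
      rwa [zero_cpow (by exact_mod_cast (sub_pos.2 hc).ne')] at h2
    have l1 := ((an1.comp hx0).const_mul A').add ((hp.mul (an3.comp hx0)).const_mul B')
    have l2 := t2.comp hsub
    have := tendsto_nhds_unique (l1.congr' ?_) l2
    · simpa using this
    · filter_upwards [Ioo_mem_nhdsGT one_pos] with x hx
      have := h _ (ofReal_mem_lens hx)
      simp [this]
  have hB' : B' = B := by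
    have hp : Tendsto (fun x : ℝ => (x : ℂ) ^ (1 - c : ℂ)) (𝓝[<] 1) (𝓝 1) := by
      have : ContinuousAt (fun x : ℂ => x ^ (1 - c : ℂ)) 1 :=
        continuousAt_cpow_const (by simp)
      have h2 := this.tendsto.comp hx1
      rwa [one_cpow] at h2
    have l1 := (t1.const_mul A').add ((hp.mul t3).const_mul B')
    have hx1' : Tendsto (fun x : ℝ => (1 - x : ℂ)) (𝓝[<] 1) (𝓝 0) := by
      simpa using hx1.const_sub 1
    have l2 := an2.comp hx1'
    have := tendsto_nhds_unique (l1.congr' ?_) l2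
    · have hB2 : (A * (Real.Gamma c * Real.Gamma (c - a - b) /
          (Real.Gamma (c - a) * Real.Gamma (c - b)) : ℝ) +
          B * (Real.Gamma (2 - c) * Real.Gamma (c - a - b) /
            (Real.Gamma (1 - a) * Real.Gamma (1 - b)) : ℝ) : ℂ) = 1 := by exact_mod_cast hB
      have hg : ((Real.Gamma (2 - c) * Real.Gamma (c - a - b) /
            (Real.Gamma (1 - a) * Real.Gamma (1 - b)) : ℝ) : ℂ) ≠ 0 := by
        have g1 := Real.Gamma_pos_of_pos (show 0 < 2 - c by linarith)
        have g2 := Real.Gamma_pos_of_pos (show 0 < c - a - b by linarith)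
        have g3 := Real.Gamma_pos_of_pos (show 0 < 1 - a by linarith)
        have g4 := Real.Gamma_pos_of_pos (show 0 < 1 - b by linarith)
        exact_mod_cast (by positivity : 0 < Real.Gamma (2 - c) * Real.Gamma (c - a - b) /
            (Real.Gamma (1 - a) * Real.Gamma (1 - b))).ne'
      refine mul_right_cancel₀ hg ?_
      rw [hA'] at this
      push_cast at this hB2 ⊢
      linear_combination this - hB2
    · filter_upwards [Ioo_mem_nhdsLT one_pos] with x hx
      have := h _ (ofReal_mem_lens hx)
      simp [this]
  rw [h z hz, hA', hB']

/-- The connection formula on the slit unit disk. -/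
theorem hypF_one_sub_eq {a b c : ℝ} (ha : 0 < a) (hb : 0 < b) (habc : a + b < c)
    (hc : c < 1) {A B : ℝ}
    (hA : A = Real.Gamma (a + b + 1 - c) * Real.Gamma (1 - c) /
      (Real.Gamma (b + 1 - c) * Real.Gamma (a + 1 - c)))
    (hB : A * (Real.Gamma c * Real.Gamma (c - a - b) / (Real.Gamma (c - a) * Real.Gamma (c - b))) +
      B * (Real.Gamma (2 - c) * Real.Gamma (c - a - b) /
        (Real.Gamma (1 - a) * Real.Gamma (1 - b))) = 1) {z : ℂ} (hz : ‖z‖ < 1)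
    (hz' : z ∈ slitPlane) :
      hypF a b (a + b + 1 - c) (1 - z) = A * ₂F₁ (a : ℂ) (b : ℂ) (c : ℂ) z +
        B * (z ^ (1 - c : ℂ) * ₂F₁ (a + 1 - c : ℂ) (b + 1 - c : ℂ) (2 - c : ℂ) z) := by
  have hcont := isHypergeometricContinuation_hypF (a := a) (b := b) (c := a + b + 1 - c)
    (by simpa) (by simp; linarith)
  have n1 := natCast_ne_neg_params ha hb (show 0 < c by linarith)
  have n3 := natCast_ne_neg_params (show 0 < a + 1 - c by linarith)
    (show 0 < b + 1 - c by linarith) (show 0 < 2 - c by linarith)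
  push_cast at n3
  have hpre : IsPreconnected (slitPlane ∩ Metric.ball (0 : ℂ) 1) := by
    have hhalf : ((1 / 2 : ℝ) : ℂ) ∈ Metric.ball (0 : ℂ) 1 :=
      (ofReal_mem_lens (by norm_num : (1 / 2 : ℝ) ∈ Set.Ioo (0 : ℝ) 1)).1
    have hstar : StarConvex ℝ ((1 / 2 : ℝ) : ℂ) (slitPlane ∩ Metric.ball (0 : ℂ) 1) :=
      (starConvex_ofReal_slitPlane (by norm_num)).inter ((convex_ball _ _).starConvex hhalf)
    exact (hstar.isPathConnected ⟨ofReal_mem_slitPlane.2 (by norm_num), hhalf⟩).isConnected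
      |>.isPreconnected
  have hlens : lens ∈ 𝓝 ((1 / 2 : ℝ) : ℂ) :=
    isOpen_lens.mem_nhds (ofReal_mem_lens (by norm_num))
  have hopen : IsOpen (slitPlane ∩ Metric.ball (0 : ℂ) 1) :=
    isOpen_slitPlane.inter Metric.isOpen_ball
  have hl : AnalyticOnNhd ℂ (fun z : ℂ => hypF a b (a + b + 1 - c) (1 - z))
      (slitPlane ∩ Metric.ball (0 : ℂ) 1) := by
    refine DifferentiableOn.analyticOnNhd ?_ hopen
    refine hcont.1.comp (by fun_prop) fun w hw => ?_
    simpa [cutPlane] using hw.1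
  have hr : AnalyticOnNhd ℂ (fun z : ℂ => A * ₂F₁ (a : ℂ) (b : ℂ) (c : ℂ) z +
        B * (z ^ (1 - c : ℂ) * ₂F₁ (a + 1 - c : ℂ) (b + 1 - c : ℂ) (2 - c : ℂ) z))
      (slitPlane ∩ Metric.ball (0 : ℂ) 1) := by
    intro w hw
    have hw1 : ‖w‖ < 1 := by simpa using hw.2
    have p : AnalyticAt ℂ (fun z : ℂ => z ^ (1 - c : ℂ)) w :=
      analyticAt_id.cpow analyticAt_const hw.1
    exact (analyticAt_const.mul (analyticAt_hypergeometric n1 hw1)).add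
      (analyticAt_const.mul (p.mul (analyticAt_hypergeometric n3 hw1)))
  refine hl.eqOn_of_preconnected_of_eventuallyEq hr hpre
    (z₀ := ((1 / 2 : ℝ) : ℂ)) ⟨ofReal_mem_slitPlane.2 (by norm_num), (mem_of_mem_nhds hlens).1⟩ ?_
    ⟨hz', by simpa using hz⟩
  filter_upwards [hlens] with w hw
  rw [hcont.2 _ (norm_one_sub_lt_one_of_mem_lens hw)]
  exact connection_on_lens ha hb habc hc hA hB hw

/-! ### Wirtinger calculus -/

local notation "conj" => starRingEnd ℂ

/-- `f` is real differentiable at `z` with `∂f = p` and `∂̄f = q`. -/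
def HasWirtinger (f : ℂ → ℂ) (p q z : ℂ) : Prop :=
  HasFDerivAt f (p • (1 : ℂ →L[ℝ] ℂ) + q • (conjCLE : ℂ →L[ℝ] ℂ)) z

namespace HasWirtinger

variable {f g : ℂ → ℂ} {p q p' q' z : ℂ}

theorem wirtinger_eq (h : HasWirtinger f p q z) : wirtinger f z = p := by
  rw [wirtinger, HasFDerivAt.fderiv h]
  simp
  linear_combination (p - q) / 2 * (-I_sq)

theorem wirtingerBar_eq (h : HasWirtinger f p q z) : wirtingerBar f z = q := by
  rw [wirtingerBar, HasFDerivAt.fderiv h]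
  simp
  linear_combination (p - q) / 2 * (I_sq)

theorem congr_of_eventuallyEq (h : HasWirtinger f p q z) (hg : g =ᶠ[𝓝 z] f) :
    HasWirtinger g p q z := HasFDerivAt.congr_of_eventuallyEq h hg

theorem congr_values (h : HasWirtinger f p q z) (hp : p = p') (hq : q = q') :
    HasWirtinger f p' q' z := hp ▸ hq ▸ h

theorem add (hf : HasWirtinger f p q z) (hg : HasWirtinger g p' q' z) :
    HasWirtinger (fun z => f z + g z) (p + p') (q + q') z := by
  refine (HasFDerivAt.add hf hg).congr_fderiv ?_
  ext
  simp
  ring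

theorem mul (hf : HasWirtinger f p q z) (hg : HasWirtinger g p' q' z) :
    HasWirtinger (fun z => f z * g z) (p * g z + f z * p') (q * g z + f z * q') z := by
  refine (HasFDerivAt.mul hf hg).congr_fderiv ?_
  ext
  simp
  ring

theorem of_hasDerivAt {d : ℂ} (h : HasDerivAt f d z) : HasWirtinger f d 0 z := by
  refine (h.hasFDerivAt.restrictScalars ℝ).congr_fderiv ?_
  ext
  simp [mul_comm]

theorem conj_of_hasDerivAt {d : ℂ} (h : HasDerivAt f d z) :
    HasWirtinger (fun z => conj (f z)) 0 (conj d) z := by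
  refine ((conjCLE : ℂ →L[ℝ] ℂ).hasFDerivAt.comp z
    (h.hasFDerivAt.restrictScalars ℝ)).congr_fderiv ?_
  ext
  simp [mul_comm]

theorem comp {σ : ℂ → ℂ} {d : ℂ} (hσ : HasDerivAt σ d (f z)) (hf : HasWirtinger f p q z) :
    HasWirtinger (fun z => σ (f z)) (d * p) (d * q) z := by
  refine ((hσ.hasFDerivAt.restrictScalars ℝ).comp z hf).congr_fderiv ?_
  ext
  simp
  ring

end HasWirtinger

theorem wirtingerBar_eq_conj (f : ℂ → ℂ) (z : ℂ) :
    wirtingerBar f z = conj (wirtinger (fun w => conj (f w)) z) := by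
  have h : fderiv ℝ (fun w => conj (f w)) z = (conjCLE : ℂ →L[ℝ] ℂ).comp (fderiv ℝ f z) :=
    conjCLE.comp_fderiv
  simp [wirtinger, wirtingerBar, h, map_ofNat]

theorem iterate_wirtingerBar_eq_conj (n : ℕ) (f : ℂ → ℂ) :
    wirtingerBar^[n] f = fun z => conj (wirtinger^[n] (fun w => conj (f w)) z) := by
  induction n with
  | zero => simp
  | succ n ih =>
    rw [Function.iterate_succ_apply', Function.iterate_succ_apply', ih]
    funext z
    rw [wirtingerBar_eq_conj]
    simp

/-! ### Scale-invariant derivatives near a puncture -/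

/-- Near the puncture `0`, `z ∂f = g` and `z̄ ∂̄f = h`. -/
def HasEulerDeriv (f g h : ℂ → ℂ) : Prop :=
  ∀ᶠ z in 𝓝[≠] (0 : ℂ), HasWirtinger f (g z / z) (h z / conj z) z

namespace HasEulerDeriv

variable {f g h f' g' h' : ℂ → ℂ}

theorem congr_values (H : HasEulerDeriv f g h) (hg : ∀ z, g z = g' z) (hh : ∀ z, h z = h' z) :
    HasEulerDeriv f g' h' := funext hg ▸ funext hh ▸ H

theorem add (H : HasEulerDeriv f g h) (H' : HasEulerDeriv f' g' h') :
    HasEulerDeriv (fun z => f z + f' z) (fun z => g z + g' z) (fun z => h z + h' z) := by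
  filter_upwards [H, H'] with z hz hz'
  exact (hz.add hz').congr_values (by ring) (by ring)

theorem mul (H : HasEulerDeriv f g h) (H' : HasEulerDeriv f' g' h') :
    HasEulerDeriv (fun z => f z * f' z) (fun z => g z * f' z + f z * g' z)
      (fun z => h z * f' z + f z * h' z) := by
  filter_upwards [H, H'] with z hz hz'
  exact (hz.mul hz').congr_values (by ring) (by ring)

theorem analytic (hf : AnalyticAt ℂ f 0) :
    HasEulerDeriv f (fun z => z * deriv f z) (fun _ => 0) := by
  filter_upwards [eventually_nhdsWithin_of_eventually_nhds hf.eventually_analyticAt,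
    self_mem_nhdsWithin] with z hz hz0
  have hz0 : z ≠ 0 := hz0
  exact (HasWirtinger.of_hasDerivAt hz.differentiableAt.hasDerivAt).congr_values
    (by field_simp) (by simp)

theorem conj_analytic (hf : AnalyticAt ℂ f 0) :
    HasEulerDeriv (fun z => conj (f z)) (fun _ => 0) (fun z => conj (z * deriv f z)) := by
  filter_upwards [eventually_nhdsWithin_of_eventually_nhds hf.eventually_analyticAt,
    self_mem_nhdsWithin] with z hz hz0
  have hz0 : conj z ≠ 0 := (map_ne_zero _).2 hz0
  refine (HasWirtinger.conj_of_hasDerivAt hz.differentiableAt.hasDerivAt).congr_values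
    (by simp) ?_
  rw [map_mul]
  field_simp

theorem const_mul (c : ℂ) (H : HasEulerDeriv f g h) :
    HasEulerDeriv (fun z => c * f z) (fun z => c * g z) (fun z => c * h z) :=
  ((analytic (f := fun _ => c) analyticAt_const).mul H).congr_values (by simp) (by simp)

theorem comp {σ d : ℂ → ℂ} (H : HasEulerDeriv f g h)
    (hσ : ∀ᶠ z in 𝓝[≠] (0 : ℂ), HasDerivAt σ (d (f z)) (f z)) :
    HasEulerDeriv (fun z => σ (f z)) (fun z => d (f z) * g z) (fun z => d (f z) * h z) := by
  filter_upwards [H, hσ] with z hz hz'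
  exact (HasWirtinger.comp hz' hz).congr_values (by ring) (by ring)

theorem congr_of_eventuallyEq (H : HasEulerDeriv f g h) (hf : f' =ᶠ[𝓝[≠] 0] f) :
    HasEulerDeriv f' g h := by
  filter_upwards [H, eventually_nhdsNE_eventually_nhds_iff.2 hf] with z hz hz'
  exact hz.congr_of_eventuallyEq hz'

theorem div_pow {n m : ℕ} (H : HasEulerDeriv g g' h')
    (hf : ∀ᶠ z in 𝓝[≠] (0 : ℂ), z ^ n * conj z ^ m * f z = g z) :
    HasEulerDeriv f (fun z => (g' z - n * g z) / (z ^ n * conj z ^ m))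
      (fun z => (h' z - m * g z) / (z ^ n * conj z ^ m)) := by
  filter_upwards [H, eventually_nhdsNE_eventually_nhds_iff.2 hf, self_mem_nhdsWithin]
    with z hz hf hz0
  have hz0 : z ≠ 0 := hz0
  have hz1 : conj z ≠ 0 := (map_ne_zero _).2 hz0
  have h1 : HasWirtinger (fun w => (w ^ n)⁻¹) (-(n / z) * (z ^ n)⁻¹) 0 z := by
    refine HasWirtinger.of_hasDerivAt (((hasDerivAt_pow n z).inv (pow_ne_zero n hz0)).congr_deriv ?_)
    rcases n with _ | n
    · simp
    · field_simp
      simp [pow_succ]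
  have h2 : HasWirtinger (fun w => conj ((w ^ m)⁻¹)) 0 (-(m / conj z) * (conj z ^ m)⁻¹) z := by
    refine (HasWirtinger.conj_of_hasDerivAt
      ((hasDerivAt_pow m z).inv (pow_ne_zero m hz0))).congr_values rfl ?_
    rcases m with _ | m
    · simp
    · simp only [map_neg, map_mul, map_div₀, map_pow, map_natCast]
      field_simp
      simp [pow_succ]
  refine (((h1.mul h2).mul hz).congr_of_eventuallyEq ?_).congr_values ?_ ?_
  · filter_upwards [hf, eventually_ne_nhds hz0] with w hw hw0
    have hw1 : conj w ≠ 0 := (map_ne_zero _).2 hw0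
    rw [← hw, map_inv₀, map_pow]
    field_simp
  · rw [map_inv₀, map_pow]
    field_simp
    ring
  · rw [map_inv₀, map_pow]
    field_simp
    ring

theorem wirtinger_step {n m : ℕ} (H : HasEulerDeriv g g' h')
    (hf : ∀ᶠ z in 𝓝[≠] (0 : ℂ), z ^ n * conj z ^ m * f z = g z) :
    ∀ᶠ z in 𝓝[≠] (0 : ℂ), z ^ (n + 1) * conj z ^ m * wirtinger f z = g' z - n * g z := by
  filter_upwards [H.div_pow hf, self_mem_nhdsWithin] with z hz hz0
  have hz0 : z ≠ 0 := hz0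
  have hz1 : conj z ≠ 0 := (map_ne_zero _).2 hz0
  rw [hz.wirtinger_eq]
  field_simp
  ring

theorem wirtingerBar_step {n m : ℕ} (H : HasEulerDeriv g g' h')
    (hf : ∀ᶠ z in 𝓝[≠] (0 : ℂ), z ^ n * conj z ^ m * f z = g z) :
    ∀ᶠ z in 𝓝[≠] (0 : ℂ), z ^ n * conj z ^ (m + 1) * wirtingerBar f z = h' z - m * g z := by
  filter_upwards [H.div_pow hf, self_mem_nhdsWithin] with z hz hz0
  have hz0 : z ≠ 0 := hz0
  have hz1 : conj z ≠ 0 := (map_ne_zero _).2 hz0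
  rw [hz.wirtingerBar_eq]
  field_simp
  ring

end HasEulerDeriv

/-- The algebra generated by germs of holomorphic and antiholomorphic functions at `0` and by `S`. -/
inductive PunctureAlgebra (S : ℂ → ℂ) : (ℂ → ℂ) → Prop
  | analytic (f : ℂ → ℂ) : AnalyticAt ℂ f 0 → PunctureAlgebra S f
  | conj_analytic (f : ℂ → ℂ) : AnalyticAt ℂ f 0 → PunctureAlgebra S fun z => conj (f z)
  | gen : PunctureAlgebra S S
  | add (f g : ℂ → ℂ) : PunctureAlgebra S f → PunctureAlgebra S g →
      PunctureAlgebra S fun z => f z + g z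
  | mul (f g : ℂ → ℂ) : PunctureAlgebra S f → PunctureAlgebra S g →
      PunctureAlgebra S fun z => f z * g z

namespace PunctureAlgebra

variable {S f P : ℂ → ℂ}

theorem isBigO_one (hS : Tendsto S (𝓝[≠] 0) (𝓝 0)) (hf : PunctureAlgebra S f) :
    f =O[𝓝[≠] 0] fun _ => (1 : ℂ) := by
  induction hf with
  | analytic f hf =>
    exact (hf.continuousAt.tendsto.mono_left nhdsWithin_le_nhds).isBigO_one ℂ
  | conj_analytic f hf =>
    exact ((continuous_conj.continuousAt.comp hf.continuousAt).tendsto.mono_left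
      nhdsWithin_le_nhds).isBigO_one ℂ
  | gen => exact hS.isBigO_one ℂ
  | add f g _ _ hf hg => exact hf.add hg
  | mul f g _ _ hf hg => simpa using hf.mul hg

theorem exists_hasEulerDeriv (hP : AnalyticAt ℂ P 0)
    (hS : HasEulerDeriv S (fun z => S z * (1 - S z) * P z) (fun z => S z * (1 - S z) * conj (P z)))
    (hf : PunctureAlgebra S f) :
    ∃ g h, PunctureAlgebra S g ∧ PunctureAlgebra S h ∧ HasEulerDeriv f g h := by
  have zero : PunctureAlgebra S fun _ => 0 := analytic _ analyticAt_const
  induction hf with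
  | analytic f hf =>
    exact ⟨_, _, analytic _ (analyticAt_id.mul hf.deriv), zero, HasEulerDeriv.analytic hf⟩
  | conj_analytic f hf =>
    exact ⟨_, _, zero, conj_analytic _ (analyticAt_id.mul hf.deriv), HasEulerDeriv.conj_analytic hf⟩
  | gen =>
    have h1 : PunctureAlgebra S fun z => S z * (1 - S z) :=
      mul _ _ gen (by
        simpa [sub_eq_add_neg] using add _ _ (analytic (fun _ => 1) analyticAt_const)
          (mul _ _ (analytic (fun _ => -1) analyticAt_const) gen))
    exact ⟨_, _, mul _ _ h1 (analytic _ hP), mul _ _ h1 (conj_analytic _ hP), hS⟩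
  | add f g _ _ hf hg =>
    obtain ⟨f1, f2, hf1, hf2, hf⟩ := hf
    obtain ⟨g1, g2, hg1, hg2, hg⟩ := hg
    exact ⟨_, _, add _ _ hf1 hg1, add _ _ hf2 hg2, hf.add hg⟩
  | mul f g hfA hgA hf hg =>
    obtain ⟨f1, f2, hf1, hf2, hf⟩ := hf
    obtain ⟨g1, g2, hg1, hg2, hg⟩ := hg
    exact ⟨_, _, add _ _ (mul _ _ hf1 hgA) (mul _ _ hfA hg1),
      add _ _ (mul _ _ hf2 hgA) (mul _ _ hfA hg2), hf.mul hg⟩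

end PunctureAlgebra

section Expansion

variable {u S P r₁ : ℂ → ℂ} {κ s : ℂ}

/-- The expansion of `zⁿ ∂ⁿu` in powers of `S`, up to `O(S²)`. -/
theorem exists_expansion_wirtinger (hP : AnalyticAt ℂ P 0) (hP0 : P 0 = s)
    (hr : AnalyticAt ℂ r₁ 0) (hr0 : r₁ 0 = κ)
    (hS : HasEulerDeriv S (fun z => S z * (1 - S z) * P z) (fun z => S z * (1 - S z) * conj (P z)))
    (hu : ∃ h, HasEulerDeriv u (fun z => r₁ z - S z * P z) h) (n : ℕ) :
    ∃ r p R, AnalyticAt ℂ r 0 ∧ AnalyticAt ℂ p 0 ∧ PunctureAlgebra S R ∧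
      r 0 = κ * (-1) ^ n * n.factorial ∧ p 0 = ∏ j ∈ Finset.range (n + 1), (s - j) ∧
      ∀ᶠ z in 𝓝[≠] (0 : ℂ), z ^ (n + 1) * wirtinger^[n + 1] u z =
        r z - S z * p z - S z ^ 2 * R z := by
  induction n with
  | zero =>
    obtain ⟨h, hu⟩ := hu
    refine ⟨r₁, P, fun _ => 0, hr, hP, .analytic _ analyticAt_const, by simp [hr0], by simp [hP0], ?_⟩
    filter_upwards [hu.wirtinger_step (n := 0) (m := 0) (f := u) (by simp)] with z hz
    simpa using hz
  | succ n ih =>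
    obtain ⟨r, p, R, hra, hpa, hR, hr0', hp0', he⟩ := ih
    obtain ⟨R1, R2, hR1, hR2, hRd⟩ := hR.exists_hasEulerDeriv hP hS
    have hd := ((HasEulerDeriv.analytic hra).add
      ((hS.mul (HasEulerDeriv.analytic hpa)).const_mul (-1))).add
        (((hS.mul hS).mul hRd).const_mul (-1))
    have hstep := hd.wirtinger_step (n := n + 1) (m := 0) (f := wirtinger^[n + 1] u) (by
      filter_upwards [he] with z hz
      rw [pow_zero, mul_one, hz]
      ring)
    refine ⟨fun z => z * deriv r z - (n + 1 : ℕ) * r z,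
      fun z => P z * p z + z * deriv p z - (n + 1 : ℕ) * p z,
      fun z => (-P z * p z + (2 * P z + -(n + 1 : ℕ))* R z) + (((-2 * P z) * S z) * R z + R1 z),
      (analyticAt_id.mul hra.deriv).sub (analyticAt_const.mul hra),
      ((hP.mul hpa).add (analyticAt_id.mul hpa.deriv)).sub (analyticAt_const.mul hpa), ?_, ?_, ?_, ?_⟩
    · exact .add _ _ (.add _ _ (.analytic _ (hP.neg.mul hpa)) (.mul _ _ (.analytic _
        ((analyticAt_const.mul hP).add analyticAt_const)) hR))
        (.add _ _ (.mul _ _ (.mul _ _ (.analytic _ (analyticAt_const.mul hP)) .gen) hR) hR1)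
    · simp only [hr0', zero_mul, Nat.factorial_succ]
      push_cast
      ring
    · rw [Finset.prod_range_succ, ← hp0', ← hP0]
      ring
    · filter_upwards [hstep] with z hz
      rw [pow_zero, mul_one, ← Function.iterate_succ_apply' wirtinger] at hz
      rw [hz]
      ring

/-- The expansion of `zⁿ z̄ᵐ ∂̄ᵐ∂ⁿu` in powers of `S`, up to `O(S²)`. -/
theorem exists_expansion_mixed (hP : AnalyticAt ℂ P 0) (hP0 : P 0 = s)
    (hr : AnalyticAt ℂ r₁ 0) (hr0 : r₁ 0 = κ)
    (hS : HasEulerDeriv S (fun z => S z * (1 - S z) * P z) (fun z => S z * (1 - S z) * conj (P z)))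
    (hu : ∃ h, HasEulerDeriv u (fun z => r₁ z - S z * P z) h) (n m : ℕ) :
    ∃ r p q R, AnalyticAt ℂ r 0 ∧ AnalyticAt ℂ p 0 ∧ AnalyticAt ℂ q 0 ∧ PunctureAlgebra S R ∧
      (m ≠ 0 → ∀ z, r z = 0) ∧ p 0 = ∏ j ∈ Finset.range (n + 1), (s - j) ∧
      q 0 = ∏ j ∈ Finset.range m, (s - j) ∧
      ∀ᶠ z in 𝓝[≠] (0 : ℂ), z ^ (n + 1) * conj z ^ m * wirtingerBar^[m] (wirtinger^[n + 1] u) z =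
        r z - S z * (p z * conj (q z)) - S z ^ 2 * R z := by
  induction m with
  | zero =>
    obtain ⟨r, p, R, hra, hpa, hR, hr0', hp0', he⟩ := exists_expansion_wirtinger hP hP0 hr hr0 hS hu n
    refine ⟨r, p, fun _ => 1, R, hra, hpa, analyticAt_const, hR, by simp, hp0', by simp, ?_⟩
    filter_upwards [he] with z hz
    simpa using hz
  | succ m ih =>
    obtain ⟨r, p, q, R, hra, hpa, hqa, hR, hr0', hp0', hq0, he⟩ := ih
    obtain ⟨R1, R2, hR1, hR2, hRd⟩ := hR.exists_hasEulerDeriv hP hS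
    have hd := ((HasEulerDeriv.analytic hra).add
      ((hS.mul ((HasEulerDeriv.analytic hpa).mul
        (HasEulerDeriv.conj_analytic hqa))).const_mul (-1))).add
        (((hS.mul hS).mul hRd).const_mul (-1))
    have hstep := hd.wirtingerBar_step (n := n + 1) (m := m)
      (f := wirtingerBar^[m] (wirtinger^[n + 1] u)) (by
      filter_upwards [he] with z hz
      rw [hz]
      ring)
    refine ⟨fun _ => 0, p, fun z => P z * q z + z * deriv q z - m * q z,
      fun z => (-(p z)) * conj (P z * q z) + ((conj (2 * P z - m)) * R z +
        (conj (-2 * P z) * (S z * R z) + R2 z)), analyticAt_const, hpa,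
      ((hP.mul hqa).add (analyticAt_id.mul hqa.deriv)).sub (analyticAt_const.mul hqa), ?_,
      fun _ _ => rfl, hp0', ?_, ?_⟩
    · exact .add _ _ (.mul _ _ (.analytic _ hpa.neg) (.conj_analytic _ (hP.mul hqa)))
        (.add _ _ (.mul _ _ (.conj_analytic _ ((analyticAt_const.mul hP).sub analyticAt_const)) hR)
          (.add _ _ (.mul _ _ (.conj_analytic _ (analyticAt_const.mul hP)) (.mul _ _ .gen hR)) hR2))
    · rw [Finset.prod_range_succ, ← hq0, ← hP0]
      ring
    · filter_upwards [hstep] with z hz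
      rw [← Function.iterate_succ_apply' wirtingerBar] at hz
      rw [hz]
      have : (m : ℂ) * r z = 0 := by
        rcases eq_or_ne m 0 with rfl | hm
        · simp
        · simp [hr0' hm]
      simp only [map_mul, map_add, map_sub, map_natCast, map_neg, map_ofNat]
      linear_combination -this

end Expansion

/-! ### Logarithms of moduli -/

/-- The real function `log |F|²`, with complex values. -/
noncomputable def logNormSq (F : ℂ → ℂ) (z : ℂ) : ℂ := ((Real.log (normSq (F z)) : ℝ) : ℂ)

theorem logNormSq_eq (F : ℂ → ℂ) (z : ℂ) : logNormSq F z = log (F z * conj (F z)) := by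
  rw [logNormSq, ofReal_log (normSq_nonneg _), mul_conj]

theorem mul_conj_mem_slitPlane {w : ℂ} (hw : w ≠ 0) : w * conj w ∈ slitPlane := by
  rw [mul_conj, ofReal_mem_slitPlane]
  exact normSq_pos.2 hw

theorem hasWirtinger_logNormSq {F : ℂ → ℂ} {d z : ℂ} (hF : HasDerivAt F d z) (hz : F z ≠ 0) :
    HasWirtinger (logNormSq F) (d / F z) (conj (d / F z)) z := by
  have hz' : conj (F z) ≠ 0 := (map_ne_zero _).2 hz
  rw [show logNormSq F = fun z => log (F z * conj (F z)) from funext (logNormSq_eq F)]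
  refine (HasWirtinger.comp (f := fun z => F z * conj (F z))
    (hasDerivAt_log (mul_conj_mem_slitPlane hz)) ((HasWirtinger.of_hasDerivAt hF).mul
      (HasWirtinger.conj_of_hasDerivAt hF))).congr_values ?_ ?_
  · field_simp
    ring
  · rw [map_div₀]
    field_simp
    ring

theorem contDiffAt_logNormSq {F : ℂ → ℂ} {z : ℂ} (hF : AnalyticAt ℂ F z) (hz : F z ≠ 0) :
    ContDiffAt ℝ ∞ (logNormSq F) z := by
  rw [show logNormSq F = fun z => log (F z * conj (F z)) from funext (logNormSq_eq F)]
  have h1 : ContDiffAt ℝ ∞ F z := hF.contDiffAt.restrict_scalars ℝ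
  have h2 : ContDiffAt ℝ ∞ (fun z => conj (F z)) z :=
    conjCLE.contDiff.contDiffAt.comp z h1
  exact ((contDiffAt_log (mul_conj_mem_slitPlane hz)).restrict_scalars ℝ).comp z (h1.mul h2)

/-- Near `0` the real function `Q` is smooth with `∂Q = q` holomorphic. -/
def HasHolomorphicWirtinger (Q q : ℂ → ℂ) : Prop :=
  AnalyticAt ℂ q 0 ∧ ∀ᶠ z in 𝓝 0, HasWirtinger Q (q z) (conj (q z)) z ∧ ContDiffAt ℝ ∞ Q z

namespace HasHolomorphicWirtinger

variable {Q q R r : ℂ → ℂ}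

theorem logNormSq {F : ℂ → ℂ} (hF : AnalyticAt ℂ F 0) (hF0 : F 0 ≠ 0) :
    HasHolomorphicWirtinger (logNormSq F) (fun z => deriv F z / F z) := by
  refine ⟨hF.deriv.div hF hF0, ?_⟩
  filter_upwards [hF.eventually_analyticAt, hF.continuousAt.eventually_ne hF0] with z hz hz0
  exact ⟨hasWirtinger_logNormSq hz.differentiableAt.hasDerivAt hz0, contDiffAt_logNormSq hz hz0⟩

theorem add (hQ : HasHolomorphicWirtinger Q q) (hR : HasHolomorphicWirtinger R r) :
    HasHolomorphicWirtinger (fun z => Q z + R z) (fun z => q z + r z) := by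
  refine ⟨hQ.1.add hR.1, ?_⟩
  filter_upwards [hQ.2, hR.2] with z hz hz'
  exact ⟨(hz.1.add hz'.1).congr_values rfl (map_add _ _ _).symm, hz.2.add hz'.2⟩

theorem const_mul (c : ℝ) (hQ : HasHolomorphicWirtinger Q q) :
    HasHolomorphicWirtinger (fun z => c * Q z) (fun z => c * q z) := by
  refine ⟨analyticAt_const.mul hQ.1, ?_⟩
  filter_upwards [hQ.2] with z hz
  exact ⟨((HasWirtinger.of_hasDerivAt (hasDerivAt_const z (c : ℂ))).mul hz.1).congr_values
    (by ring) (by simp), contDiffAt_const.mul hz.2⟩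

theorem const (c : ℂ) : HasHolomorphicWirtinger (fun _ => c) (fun _ => 0) :=
  ⟨analyticAt_const, Eventually.of_forall fun z =>
    ⟨(HasWirtinger.of_hasDerivAt (hasDerivAt_const z c)).congr_values rfl (by simp),
      contDiffAt_const⟩⟩

theorem hasEulerDeriv (hQ : HasHolomorphicWirtinger Q q) :
    HasEulerDeriv Q (fun z => z * q z) (fun z => conj (z * q z)) := by
  filter_upwards [eventually_nhdsWithin_of_eventually_nhds hQ.2, self_mem_nhdsWithin] with z hz hz0
  have hz0 : z ≠ 0 := hz0
  have hz1 : conj z ≠ 0 := (map_ne_zero _).2 hz0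
  refine hz.1.congr_values (by field_simp) ?_
  rw [map_mul]
  field_simp

theorem continuousAt (hQ : HasHolomorphicWirtinger Q q) : ContinuousAt Q 0 :=
  hQ.2.self_of_nhds.2.continuousAt

end HasHolomorphicWirtinger

theorem hasEulerDeriv_logNormSq_id :
    HasEulerDeriv (logNormSq id) (fun _ => 1) (fun _ => 1) := by
  filter_upwards [self_mem_nhdsWithin] with z hz0
  exact (hasWirtinger_logNormSq (hasDerivAt_id z) hz0).congr_values rfl (by simp)

theorem exp_mul_logNormSq_id (s : ℝ) {z : ℂ} (hz : z ≠ 0) :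
    exp (s * logNormSq id z) = ((‖z‖ ^ (2 * s) : ℝ) : ℂ) := by
  have hz' : 0 < ‖z‖ := norm_pos_iff.2 hz
  rw [Real.rpow_def_of_pos hz', logNormSq, id, normSq_eq_norm_sq, Real.log_pow]
  push_cast
  ring_nf

/-! ### Asymptotics near a conical puncture -/

section Conical

variable {Q q R r : ℂ → ℂ} {s k κ : ℝ}

theorem tendsto_exp_conical (hs : 0 < s) (hQ : HasHolomorphicWirtinger Q q) :
    Tendsto (fun z => (k : ℂ) * exp (s * logNormSq id z + Q z)) (𝓝[≠] 0) (𝓝 0) := by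
  have h1 : Tendsto (fun z : ℂ => ((‖z‖ ^ (2 * s) : ℝ) : ℂ)) (𝓝[≠] 0) (𝓝 0) := by
    have : ContinuousAt (fun z : ℂ => ((‖z‖ ^ (2 * s) : ℝ) : ℂ)) 0 :=
      continuous_ofReal.continuousAt.comp
        (continuousAt_id.norm.rpow_const (Or.inr (by positivity)))
    have h2 := this.tendsto.mono_left (nhdsWithin_le_nhds (s := {0}ᶜ))
    simpa [Real.zero_rpow (by positivity : 2 * s ≠ 0)] using h2
  have h2 : Tendsto (fun z => exp (Q z)) (𝓝[≠] 0) (𝓝 (exp (Q 0))) :=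
    (continuous_exp.continuousAt.comp hQ.continuousAt).tendsto.mono_left nhdsWithin_le_nhds
  have h3 := (h1.mul h2).const_mul (k : ℂ)
  rw [zero_mul, mul_zero] at h3
  refine h3.congr' ?_
  filter_upwards [self_mem_nhdsWithin] with z hz
  rw [exp_add, exp_mul_logNormSq_id s hz]

theorem eventually_one_add_exp_mem_slitPlane (hs : 0 < s) (hQ : HasHolomorphicWirtinger Q q) :
    ∀ᶠ z in 𝓝[≠] (0 : ℂ), 1 + k * exp (s * logNormSq id z + Q z) ∈ slitPlane := by
  have h := (tendsto_exp_conical (k := k) hs hQ).const_add 1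
  rw [add_zero] at h
  exact h (isOpen_slitPlane.mem_nhds one_mem_slitPlane)

/-- The logistic factor `k e^L / (1 + k e^L)` with `L = s log |z|² + Q`. -/
noncomputable def logistic (k s : ℝ) (Q : ℂ → ℂ) (z : ℂ) : ℂ :=
  k * exp (s * logNormSq id z + Q z) / (1 + k * exp (s * logNormSq id z + Q z))

theorem tendsto_logistic (hs : 0 < s) (hQ : HasHolomorphicWirtinger Q q) :
    Tendsto (logistic k s Q) (𝓝[≠] 0) (𝓝 0) := by
  have h := tendsto_exp_conical (k := k) hs hQ
  have h2 := h.div (h.const_add 1) (by simp)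
  rw [zero_div] at h2
  exact h2

theorem tendsto_rpow_mul_logistic (hs : 0 < s) (hQ : HasHolomorphicWirtinger Q q) :
    Tendsto (fun z : ℂ => ((‖z‖ ^ (-(2 * s)) : ℝ) : ℂ) * logistic k s Q z) (𝓝[≠] 0)
      (𝓝 (k * exp (Q 0))) := by
  have h := tendsto_exp_conical (k := k) hs hQ
  have h2 : Tendsto (fun z => exp (Q z)) (𝓝[≠] 0) (𝓝 (exp (Q 0))) :=
    (continuous_exp.continuousAt.comp hQ.continuousAt).tendsto.mono_left nhdsWithin_le_nhds
  have h3 := (h2.const_mul (k : ℂ)).div (h.const_add 1) (by simp)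
  rw [add_zero, div_one] at h3
  refine h3.congr' ?_
  filter_upwards [self_mem_nhdsWithin] with z hz
  have hz' : 0 < ‖z‖ := norm_pos_iff.2 hz
  have h4 : ((‖z‖ ^ (2 * s) : ℝ) : ℂ) ≠ 0 := by
    exact_mod_cast (Real.rpow_pos_of_pos hz' _).ne'
  rw [logistic, exp_add, exp_mul_logNormSq_id s hz, Real.rpow_neg hz'.le, ofReal_inv,
    Pi.div_apply, exp_add, exp_mul_logNormSq_id s hz]
  field_simp

theorem hasEulerDeriv_conicalExponent (hQ : HasHolomorphicWirtinger Q q) :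
    HasEulerDeriv (fun z => s * logNormSq id z + Q z) (fun z => s + z * q z)
      (fun z => conj (s + z * q z)) :=
  ((hasEulerDeriv_logNormSq_id.const_mul s).add hQ.hasEulerDeriv).congr_values (by simp) (by simp)

theorem hasEulerDeriv_logistic (hs : 0 < s) (hQ : HasHolomorphicWirtinger Q q) :
    HasEulerDeriv (logistic k s Q)
      (fun z => logistic k s Q z * (1 - logistic k s Q z) * (s + z * q z))
      (fun z => logistic k s Q z * (1 - logistic k s Q z) * conj (s + z * q z)) := by
  refine (hasEulerDeriv_conicalExponent hQ).comp (σ := fun w => k * exp w / (1 + k * exp w))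
    (d := fun w => k * exp w / (1 + k * exp w) * (1 - k * exp w / (1 + k * exp w))) ?_
  filter_upwards [eventually_one_add_exp_mem_slitPlane (k := k) hs hQ] with z hz
  have h0 := slitPlane_ne_zero hz
  generalize (s * logNormSq id z + Q z : ℂ) = w at h0 ⊢
  have h1 := (hasDerivAt_exp w).const_mul (k : ℂ)
  refine (h1.div (h1.const_add 1) h0).congr_deriv ?_
  field_simp

theorem hasEulerDeriv_log_one_add_exp (hs : 0 < s) (hQ : HasHolomorphicWirtinger Q q) :
    HasEulerDeriv (fun z => log (1 + k * exp (s * logNormSq id z + Q z)))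
      (fun z => logistic k s Q z * (s + z * q z))
      (fun z => logistic k s Q z * conj (s + z * q z)) := by
  refine (hasEulerDeriv_conicalExponent hQ).comp (σ := fun w => log (1 + k * exp w))
    (d := fun w => k * exp w / (1 + k * exp w)) ?_
  filter_upwards [eventually_one_add_exp_mem_slitPlane (k := k) hs hQ] with z hz
  exact (((hasDerivAt_exp _).const_mul (k : ℂ)).const_add 1).clog hz

variable {u : ℂ → ℂ}

theorem contDiffAt_conical (hs : 0 < s) (hQ : HasHolomorphicWirtinger Q q)
    (hR : HasHolomorphicWirtinger R r)
    (hu : ∀ᶠ z in 𝓝[≠] (0 : ℂ), u z = -κ * logNormSq id z + R z -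
      log (1 + k * exp (s * logNormSq id z + Q z))) :
    ∀ᶠ z in 𝓝[≠] (0 : ℂ), ContDiffAt ℝ ∞ u z := by
  filter_upwards [eventually_nhdsNE_eventually_nhds_iff.2 hu, self_mem_nhdsWithin,
    eventually_nhdsWithin_of_eventually_nhds hQ.2, eventually_nhdsWithin_of_eventually_nhds hR.2,
    eventually_one_add_exp_mem_slitPlane (k := k) hs hQ] with z hz hz0 hQz hRz hslit
  refine ContDiffAt.congr_of_eventuallyEq ?_ hz
  have hl : ContDiffAt ℝ ∞ (logNormSq id) z := contDiffAt_logNormSq analyticAt_id hz0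
  have he : ContDiffAt ℝ ∞ (fun z => 1 + k * exp (s * logNormSq id z + Q z)) z :=
    contDiffAt_const.add (contDiffAt_const.mul
      (((contDiff_exp (𝕜 := ℂ)).contDiffAt.restrict_scalars ℝ).comp z
        ((contDiffAt_const.mul hl).add hQz.2)))
  have hlog : ContDiffAt ℝ ∞ (fun z => log (1 + k * exp (s * logNormSq id z + Q z))) z :=
    ContDiffAt.comp (g := log) z ((contDiffAt_log hslit).restrict_scalars ℝ) he
  exact ((contDiffAt_const.mul hl).add hRz.2).sub hlog

theorem hasEulerDeriv_conical (hs : 0 < s) (hQ : HasHolomorphicWirtinger Q q)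
    (hR : HasHolomorphicWirtinger R r)
    (hu : ∀ᶠ z in 𝓝[≠] (0 : ℂ), u z = -κ * logNormSq id z + R z -
      log (1 + k * exp (s * logNormSq id z + Q z))) :
    ∃ h, HasEulerDeriv u (fun z => (-κ + z * r z) - logistic k s Q z * (s + z * q z)) h := by
  have h := ((hasEulerDeriv_logNormSq_id.const_mul (-κ)).add hR.hasEulerDeriv).add
    ((hasEulerDeriv_log_one_add_exp (k := k) hs hQ).const_mul (-1))
  refine ⟨_, (h.congr_of_eventuallyEq ?_).congr_values (fun z => ?_) fun z => rfl⟩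
  · filter_upwards [hu] with z hz
    rw [hz]
    ring
  · ring

theorem tendsto_wirtinger_conical (hs : 0 < s) (hQ : HasHolomorphicWirtinger Q q)
    (hR : HasHolomorphicWirtinger R r)
    (hu : ∀ᶠ z in 𝓝[≠] (0 : ℂ), u z = -κ * logNormSq id z + R z -
      log (1 + k * exp (s * logNormSq id z + Q z))) (n : ℕ) :
    Tendsto (fun z => z ^ (n + 1) * wirtinger^[n + 1] u z) (𝓝[≠] 0)
      (𝓝 (-κ * (-1) ^ n * n.factorial)) := by
  obtain ⟨ρ, p, T, hρ, hp, hT, hρ0, -, he⟩ := exists_expansion_wirtinger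
    (P := fun z => s + z * q z) (s := s) (κ := -κ) (analyticAt_const.add (analyticAt_id.mul hQ.1))
    (by simp) (analyticAt_const.add (analyticAt_id.mul hR.1)) (by simp)
    (hasEulerDeriv_logistic (k := k) hs hQ) (hasEulerDeriv_conical hs hQ hR hu) n
  have hS := tendsto_logistic (k := k) hs hQ
  have hρl := hρ.continuousAt.tendsto.mono_left (nhdsWithin_le_nhds (s := {0}ᶜ))
  have hpl := hp.continuousAt.tendsto.mono_left (nhdsWithin_le_nhds (s := {0}ᶜ))
  have hTl : Tendsto (fun z => logistic k s Q z ^ 2 * T z) (𝓝[≠] 0) (𝓝 0) := by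
    have h2 : Tendsto (fun z => logistic k s Q z ^ 2) (𝓝[≠] 0) (𝓝 0) := by
      simpa using hS.pow 2
    exact h2.zero_mul_isBoundedUnder_le ((hT.isBigO_one hS).isBoundedUnder_le)
  have h := (hρl.sub (hS.mul hpl)).sub hTl
  rw [hρ0, zero_mul, sub_zero, sub_zero] at h
  refine h.congr' ?_
  filter_upwards [he] with z hz
  exact hz.symm

theorem tendsto_wirtingerBar_conical (hs : 0 < s) (hQ : HasHolomorphicWirtinger Q q)
    (hR : HasHolomorphicWirtinger R r)
    (hu : ∀ᶠ z in 𝓝[≠] (0 : ℂ), u z = -κ * logNormSq id z + R z -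
      log (1 + k * exp (s * logNormSq id z + Q z))) (hreal : ∀ z, conj (u z) = u z) (n : ℕ) :
    Tendsto (fun z => conj z ^ (n + 1) * wirtingerBar^[n + 1] u z) (𝓝[≠] 0)
      (𝓝 (-κ * (-1) ^ n * n.factorial)) := by
  have h := (continuous_conj.tendsto _).comp (tendsto_wirtinger_conical hs hQ hR hu n)
  rw [show conj (-κ * (-1) ^ n * n.factorial : ℂ) = -κ * (-1) ^ n * n.factorial by simp] at h
  refine h.congr fun z => ?_
  rw [iterate_wirtingerBar_eq_conj]
  simp [hreal]

theorem tendsto_mixed_conical (hs : 0 < s) (hQ : HasHolomorphicWirtinger Q q)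
    (hR : HasHolomorphicWirtinger R r)
    (hu : ∀ᶠ z in 𝓝[≠] (0 : ℂ), u z = -κ * logNormSq id z + R z -
      log (1 + k * exp (s * logNormSq id z + Q z))) (n m : ℕ) :
    Tendsto (fun z => conj z ^ (m + 1) * z ^ (n + 1) * ((‖z‖ ^ (-(2 * s)) : ℝ) : ℂ) *
        wirtingerBar^[m + 1] (wirtinger^[n + 1] u) z) (𝓝[≠] 0)
      (𝓝 (-(k * exp (Q 0)) * ((∏ j ∈ Finset.range (n + 1), (s - j : ℂ)) *
        ∏ j ∈ Finset.range (m + 1), (s - j : ℂ)))) := by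
  obtain ⟨ρ, p, p', T, -, hp, hp', hT, hρ0, hp0, hp0', he⟩ := exists_expansion_mixed
    (P := fun z => s + z * q z) (s := s) (κ := -κ) (analyticAt_const.add (analyticAt_id.mul hQ.1))
    (by simp) (analyticAt_const.add (analyticAt_id.mul hR.1)) (by simp)
    (hasEulerDeriv_logistic (k := k) hs hQ) (hasEulerDeriv_conical hs hQ hR hu) n (m + 1)
  have hS := tendsto_logistic (k := k) hs hQ
  have hS' := tendsto_rpow_mul_logistic (k := k) hs hQ
  have hpl := hp.continuousAt.tendsto.mono_left (nhdsWithin_le_nhds (s := {0}ᶜ))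
  have hpl' := (continuous_conj.continuousAt.comp hp'.continuousAt).tendsto.mono_left
    (nhdsWithin_le_nhds (s := {0}ᶜ))
  have hTl : Tendsto (fun z => logistic k s Q z * T z) (𝓝[≠] 0) (𝓝 0) :=
    hS.zero_mul_isBoundedUnder_le ((hT.isBigO_one hS).isBoundedUnder_le)
  have h := hS'.neg.mul ((hpl.mul hpl').add hTl)
  have hv : conj (p' 0) = ∏ j ∈ Finset.range (m + 1), (s - j : ℂ) := by
    simp [hp0']
  rw [Function.comp_apply, hv, hp0, add_zero] at h
  refine h.congr' ?_
  filter_upwards [he] with z hz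
  rw [hρ0 m.succ_ne_zero] at hz
  simp only [Function.comp_apply]
  linear_combination -((‖z‖ ^ (-(2 * s)) : ℝ) : ℂ) * hz

end Conical

/-! ### The constants -/

theorem sin_pi_mul_pos {x : ℝ} (h0 : 0 < x) (h1 : x < 1) : 0 < Real.sin (Real.pi * x) :=
  Real.sin_pos_of_pos_of_lt_pi (mul_pos Real.pi_pos h0) (by nlinarith [Real.pi_pos])

theorem sin_mul_sin_sub_sin_mul_sin (x y t : ℝ) :
    Real.sin (t - x) * Real.sin (t - y) - Real.sin t * Real.sin (t - x - y) =
      Real.sin x * Real.sin y := by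
  simp only [Real.sin_sub, Real.cos_sub]
  linear_combination Real.sin x * Real.sin y * Real.sin_sq_add_cos_sq t

theorem Gamma_mul_Gamma_one_sub_mul_sin {x : ℝ} (h0 : 0 < x) (h1 : x < 1) :
    Real.Gamma x * Real.Gamma (1 - x) * Real.sin (Real.pi * x) = Real.pi := by
  rw [Real.Gamma_mul_Gamma_one_sub]
  field_simp [(sin_pi_mul_pos h0 h1).ne']

/-- The coefficient of `F(a,b,c;z)` in the connection formula. -/
noncomputable def connA (a b c : ℝ) : ℝ :=
  Real.Gamma (a + b + 1 - c) * Real.Gamma (1 - c) /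
    (Real.Gamma (b + 1 - c) * Real.Gamma (a + 1 - c))

/-- The coefficient of `z ^ (1 - c) F(a-c+1,b-c+1,2-c;z)` in the connection formula. -/
noncomputable def connB (a b c : ℝ) : ℝ :=
  -(Real.Gamma c * Real.Gamma (a + b + 1 - c)) / (Real.Gamma a * Real.Gamma b * (1 - c))

theorem K₂_neg {a b c : ℝ} (ha : 0 < a) (hb : 0 < b) (hc : c < 1) : K₂ a b c < 0 := by
  have h1 := Real.Gamma_pos_of_pos (show 0 < a + 1 - c by linarith)
  have h2 := Real.Gamma_pos_of_pos (show 0 < b + 1 - c by linarith)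
  have h3 := Real.Gamma_pos_of_pos (show 0 < 1 - c by linarith)
  have h4 := Real.Gamma_pos_of_pos (show 0 < a + b + 1 - c by linarith)
  rw [K₂, neg_div]
  exact neg_neg_of_pos (by positivity)

theorem K₂_mul_connA {a b c : ℝ} (ha : 0 < a) (hb : 0 < b) (hc : c < 1) :
    K₂ a b c * connA a b c = -1 := by
  have h1 := Real.Gamma_pos_of_pos (show 0 < a + 1 - c by linarith)
  have h2 := Real.Gamma_pos_of_pos (show 0 < b + 1 - c by linarith)
  have h3 := Real.Gamma_pos_of_pos (show 0 < 1 - c by linarith)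
  have h4 := Real.Gamma_pos_of_pos (show 0 < a + b + 1 - c by linarith)
  rw [K₂, connA]
  field_simp

section Constants

variable {a b c : ℝ} (ha : 0 < a) (hb : 0 < b) (habc : a + b < c) (hc : c < 1)
include ha hb habc hc

theorem K₁_mul_K₂ : K₁ a b c * K₂ a b c * (Real.sin (Real.pi * (c - a)) *
    Real.sin (Real.pi * (c - b))) = Real.sin (Real.pi * c) * Real.sin (Real.pi * (c - a - b)) := by
  have h1 := Real.Gamma_pos_of_pos (show 0 < a + 1 - c by linarith)
  have h2 := Real.Gamma_pos_of_pos (show 0 < b + 1 - c by linarith)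
  have h3 := Real.Gamma_pos_of_pos (show 0 < 1 - c by linarith)
  have h4 := Real.Gamma_pos_of_pos (show 0 < a + b + 1 - c by linarith)
  have h5 := Real.Gamma_pos_of_pos (show 0 < c by linarith)
  have h6 := Real.Gamma_pos_of_pos (show 0 < c - a - b by linarith)
  have r1 := Gamma_mul_Gamma_one_sub_mul_sin (x := c) (by linarith) hc
  have r2 := Gamma_mul_Gamma_one_sub_mul_sin (x := c - a - b) (by linarith) (by linarith)
  have r3 := Gamma_mul_Gamma_one_sub_mul_sin (x := c - a) (by linarith) (by linarith)
  have r4 := Gamma_mul_Gamma_one_sub_mul_sin (x := c - b) (by linarith) (by linarith)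
  rw [show 1 - (c - a - b) = a + b + 1 - c by ring] at r2
  rw [show 1 - (c - a) = a + 1 - c by ring] at r3
  rw [show 1 - (c - b) = b + 1 - c by ring] at r4
  rw [K₁, K₂, div_mul_div_comm, div_mul_eq_mul_div, div_eq_iff (by positivity)]
  calc _ = (Real.Gamma (c - a) * Real.Gamma (a + 1 - c) * Real.sin (Real.pi * (c - a))) *
      (Real.Gamma (c - b) * Real.Gamma (b + 1 - c) * Real.sin (Real.pi * (c - b))) := by ring
    _ = (Real.Gamma c * Real.Gamma (1 - c) * Real.sin (Real.pi * c)) *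
      (Real.Gamma (c - a - b) * Real.Gamma (a + b + 1 - c) *
        Real.sin (Real.pi * (c - a - b))) := by rw [r1, r2, r3, r4]
    _ = _ := by ring

theorem one_sub_K₁_mul_K₂ : (1 - K₁ a b c * K₂ a b c) * (Real.sin (Real.pi * (c - a)) *
    Real.sin (Real.pi * (c - b))) = Real.sin (Real.pi * a) * Real.sin (Real.pi * b) := by
  have h1 := K₁_mul_K₂ ha hb habc hc
  have h2 := sin_mul_sin_sub_sin_mul_sin (Real.pi * a) (Real.pi * b) (Real.pi * c)
  simp only [← mul_sub] at h2
  linear_combination h2 - h1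

theorem one_sub_K₁_mul_K₂_pos : 0 < 1 - K₁ a b c * K₂ a b c := by
  have s1 := sin_pi_mul_pos (x := c - a) (by linarith) (by linarith)
  have s2 := sin_pi_mul_pos (x := c - b) (by linarith) (by linarith)
  have s3 := sin_pi_mul_pos (x := a) ha (by linarith)
  have s4 := sin_pi_mul_pos (x := b) hb (by linarith)
  refine pos_of_mul_pos_left ?_ (mul_pos s1 s2).le
  rw [one_sub_K₁_mul_K₂ ha hb habc hc]
  exact mul_pos s3 s4

theorem K₃_pos : 0 < K₃ a b c := by
  have s1 := sin_pi_mul_pos (x := c - a) (by linarith) (by linarith)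
  have s2 := sin_pi_mul_pos (x := c - b) (by linarith) (by linarith)
  have s3 := sin_pi_mul_pos (x := a) ha (by linarith)
  have s4 := sin_pi_mul_pos (x := b) hb (by linarith)
  have h1 := Real.Gamma_pos_of_pos ha
  have h2 := Real.Gamma_pos_of_pos hb
  have h4 := Real.Gamma_pos_of_pos (show 0 < a + b + 1 - c by linarith)
  have h5 := Real.Gamma_pos_of_pos (show 0 < c by linarith)
  exact mul_pos (Real.sqrt_pos.2 (by positivity)) (by positivity)

theorem K₁_add_connA_pos : 0 < K₁ a b c + connA a b c := by
  have h1 := one_sub_K₁_mul_K₂_pos ha hb habc hc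
  have h2 := K₂_neg ha hb hc
  have h3 := K₂_mul_connA ha hb hc
  refine (neg_iff_pos_of_mul_neg (a := K₂ a b c) ?_).1 h2
  rw [mul_add, h3]
  linarith

/-- The value at `1` of the connection formula. -/
theorem connA_add_connB : connA a b c * (Real.Gamma c * Real.Gamma (c - a - b) /
      (Real.Gamma (c - a) * Real.Gamma (c - b))) +
    connB a b c * (Real.Gamma (2 - c) * Real.Gamma (c - a - b) /
      (Real.Gamma (1 - a) * Real.Gamma (1 - b))) = 1 := by
  have g1 := Real.Gamma_pos_of_pos (show 0 < c - a by linarith)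
  have g2 := Real.Gamma_pos_of_pos (show 0 < c - b by linarith)
  have g3 := Real.Gamma_pos_of_pos (show 0 < c by linarith)
  have g4 := Real.Gamma_pos_of_pos (show 0 < c - a - b by linarith)
  have ga := Real.Gamma_pos_of_pos ha
  have gb := Real.Gamma_pos_of_pos hb
  have ga' := Real.Gamma_pos_of_pos (show 0 < 1 - a by linarith)
  have gb' := Real.Gamma_pos_of_pos (show 0 < 1 - b by linarith)
  have gc' := Real.Gamma_pos_of_pos (show 0 < 1 - c by linarith)
  have s1 := sin_pi_mul_pos (x := c) (by linarith) hc
  have s2 := sin_pi_mul_pos (x := c - a - b) (by linarith) (by linarith)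
  have hc1 : 1 - c ≠ 0 := by linarith
  have hK1 : K₁ a b c ≠ 0 := by
    rw [K₁]
    exact div_ne_zero (neg_ne_zero.2 (by positivity)) (by positivity)
  have hK2 : K₂ a b c ≠ 0 := (K₂_neg ha hb hc).ne
  have e1 : connA a b c * (Real.Gamma c * Real.Gamma (c - a - b) /
      (Real.Gamma (c - a) * Real.Gamma (c - b))) = 1 / (K₁ a b c * K₂ a b c) := by
    have h1 : Real.Gamma c * Real.Gamma (c - a - b) /
        (Real.Gamma (c - a) * Real.Gamma (c - b)) = -1 / K₁ a b c := by
      rw [K₁]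
      field_simp
    have h2 : connA a b c = -1 / K₂ a b c := by
      rw [eq_div_iff hK2, mul_comm, K₂_mul_connA ha hb hc]
    rw [h1, h2]
    field_simp
  have r1 := Gamma_mul_Gamma_one_sub_mul_sin (x := c) (by linarith) hc
  have r2 := Gamma_mul_Gamma_one_sub_mul_sin (x := c - a - b) (by linarith) (by linarith)
  have r3 := Gamma_mul_Gamma_one_sub_mul_sin (x := a) ha (by linarith)
  have r4 := Gamma_mul_Gamma_one_sub_mul_sin (x := b) hb (by linarith)
  rw [show 1 - (c - a - b) = a + b + 1 - c by ring] at r2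
  have e2 : connB a b c * (Real.Gamma (2 - c) * Real.Gamma (c - a - b) /
      (Real.Gamma (1 - a) * Real.Gamma (1 - b))) = -(Real.sin (Real.pi * a) *
        Real.sin (Real.pi * b)) / (Real.sin (Real.pi * c) * Real.sin (Real.pi * (c - a - b))) := by
    rw [connB, show 2 - c = 1 - c + 1 by ring, Real.Gamma_add_one hc1, div_mul_div_comm,
      div_eq_div_iff (by positivity) (by positivity)]
    calc _ = -(1 - c) * (Real.Gamma c * Real.Gamma (1 - c) * Real.sin (Real.pi * c)) *
        (Real.Gamma (c - a - b) * Real.Gamma (a + b + 1 - c) *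
          Real.sin (Real.pi * (c - a - b))) := by ring
      _ = -(1 - c) * (Real.Gamma a * Real.Gamma (1 - a) * Real.sin (Real.pi * a)) *
        (Real.Gamma b * Real.Gamma (1 - b) * Real.sin (Real.pi * b)) := by rw [r1, r2, r3, r4]
      _ = _ := by ring
  have h1 := K₁_mul_K₂ ha hb habc hc
  have h2 := one_sub_K₁_mul_K₂ ha hb habc hc
  rw [e1, e2, ← h1, ← h2]
  have s3 := sin_pi_mul_pos (x := c - a) (by linarith) (by linarith)
  have s4 := sin_pi_mul_pos (x := c - b) (by linarith) (by linarith)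
  field_simp
  ring

theorem neg_connQuotient_eq : -(K₂ a b c * connB a b c ^ 2 / (K₁ a b c + connA a b c)) *
    (1 - c) ^ 2 = K₂ a b c ^ 2 / (1 - K₁ a b c * K₂ a b c) *
      (Real.Gamma c * Real.Gamma (a + b - c + 1) / (Real.Gamma a * Real.Gamma b)) ^ 2 := by
  have h1 := (one_sub_K₁_mul_K₂_pos ha hb habc hc).ne'
  have h2 := (K₂_neg ha hb hc).ne
  have h3 := K₂_mul_connA ha hb hc
  have h4 := (K₁_add_connA_pos ha hb habc hc).ne'
  have ga := (Real.Gamma_pos_of_pos ha).ne'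
  have gb := (Real.Gamma_pos_of_pos hb).ne'
  have hc1 : 1 - c ≠ 0 := by linarith
  have h5 : K₁ a b c + connA a b c = -(1 - K₁ a b c * K₂ a b c) / K₂ a b c := by
    rw [eq_div_iff h2]
    linear_combination h3
  rw [h5, connB, show a + b - c + 1 = a + b + 1 - c by ring]
  generalize K₁ a b c * K₂ a b c = x at *
  field_simp

end Constants

/-! ### The density near the first conical point -/

theorem ascPochhammer_eval_ofReal (x : ℝ) (n : ℕ) :
    (ascPochhammer ℂ n).eval (x : ℂ) = ((ascPochhammer ℝ n).eval x : ℝ) := by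
  induction n with
  | zero => simp
  | succ n ih => simp [ascPochhammer_succ_eval, ih]

theorem conj_hypergeometric (a b c : ℝ) (z : ℂ) :
    starRingEnd ℂ (₂F₁ (a : ℂ) (b : ℂ) (c : ℂ) z) =
      ₂F₁ (a : ℂ) (b : ℂ) (c : ℂ) (starRingEnd ℂ z) := by
  rw [ordinaryHypergeometric_eq_tsum]
  simp only [conj_tsum]
  refine tsum_congr fun n => ?_
  simp [ascPochhammer_eval_ofReal]

/-- The hypergeometric factor of the second local solution at `0`. -/
noncomputable def secondSeries (a b c : ℝ) : ℂ → ℂ :=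
  ₂F₁ ((a + 1 - c : ℝ) : ℂ) ((b + 1 - c : ℝ) : ℂ) ((2 - c : ℝ) : ℂ)

theorem connection_quadratic_form {k₁ k₂ A B : ℝ} (hA : k₂ * A = -1) (y w : ℂ) :
    k₁ * ‖y‖ ^ 2 + k₂ * ‖A * y + B * w‖ ^ 2 + 2 * (y * starRingEnd ℂ (A * y + B * w)).re =
      (k₁ + A) * ‖y‖ ^ 2 + k₂ * B ^ 2 * ‖w‖ ^ 2 := by
  simp only [← normSq_eq_norm_sq, normSq_apply, add_re, add_im, mul_re, mul_im, ofReal_re, ofReal_im,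
    conj_re, conj_im]
  linear_combination (A * (y.re ^ 2 + y.im ^ 2) + 2 * B * (y.re * w.re + y.im * w.im)) * hA

theorem analyticAt_firstSeries {a b c : ℝ} (ha : 0 < a) (hb : 0 < b) (habc : a + b < c)
    {z : ℂ} (hz : ‖z‖ < 1) :
    AnalyticAt ℂ (₂F₁ (a : ℂ) (b : ℂ) (c : ℂ)) z :=
  analyticAt_hypergeometric (natCast_ne_neg_params ha hb (by linarith)) hz

theorem φ₁_eq {a b c : ℝ} (ha : 0 < a) (hb : 0 < b) (habc : a + b < c) {z : ℂ}
    (hz : ‖z‖ < 1) : φ₁ a b c z = ₂F₁ (a : ℂ) (b : ℂ) (c : ℂ) z :=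
  (isHypergeometricContinuation_hypF (by simpa) (by simp; linarith)).2 z hz

section Density

variable {a b c : ℝ} (ha : 0 < a) (hb : 0 < b) (habc : a + b < c) (hc : c < 1)
include ha hb habc hc

theorem analyticAt_secondSeries {z : ℂ} (hz : ‖z‖ < 1) :
    AnalyticAt ℂ (secondSeries a b c) z :=
  analyticAt_hypergeometric (natCast_ne_neg_params (by linarith) (by linarith)
    (by linarith)) hz

theorem φ₂_eq {z : ℂ} (hz : ‖z‖ < 1) (hz' : z ∈ slitPlane) :
    φ₂ a b c z = connA a b c * ₂F₁ (a : ℂ) (b : ℂ) (c : ℂ) z +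
      connB a b c * (z ^ ((1 - c : ℝ) : ℂ) * secondSeries a b c z) := by
  have h := hypF_one_sub_eq ha hb habc hc (A := connA a b c) (B := connB a b c) rfl
    (connA_add_connB ha hb habc hc) hz hz'
  rw [φ₂, secondSeries, show a + b - c + 1 = a + b + 1 - c by ring]
  push_cast
  exact h

theorem φ₂_conj {z : ℂ} (hz : ‖z‖ < 1) (hz' : z ∈ slitPlane) :
    φ₂ a b c (starRingEnd ℂ z) = starRingEnd ℂ (φ₂ a b c z) := by
  have hz'' : starRingEnd ℂ z ∈ slitPlane := by
    simpa [mem_slitPlane_iff] using hz'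
  rw [φ₂_eq ha hb habc hc hz hz', φ₂_eq ha hb habc hc (by simpa using hz) hz'', secondSeries]
  simp only [map_add, map_mul, conj_hypergeometric, conj_ofReal]
  rw [conj_cpow _ _ (slitPlane_arg_ne_pi hz'), conj_ofReal]

theorem denominator_eq {z : ℂ} (hz : ‖z‖ < 1) (hz' : z ∈ slitPlane) :
    K₁ a b c * ‖φ₁ a b c z‖ ^ 2 + K₂ a b c * ‖φ₂ a b c z‖ ^ 2 +
      2 * (φ₁ a b c z * φ₂ a b c (starRingEnd ℂ z)).re =
    (K₁ a b c + connA a b c) * ‖₂F₁ (a : ℂ) (b : ℂ) (c : ℂ) z‖ ^ 2 +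
      K₂ a b c * connB a b c ^ 2 * (‖z‖ ^ (2 * (1 - c)) * ‖secondSeries a b c z‖ ^ 2) := by
  have hz0 := slitPlane_ne_zero hz'
  rw [φ₂_conj ha hb habc hc hz hz', φ₂_eq ha hb habc hc hz hz', φ₁_eq ha hb habc hz,
    connection_quadratic_form (K₂_mul_connA ha hb hc), norm_mul, mul_pow,
    norm_cpow_real, mul_comm 2 (1 - c), Real.rpow_mul (norm_nonneg z)]
  norm_num

end Density

theorem mem_closure_slitDomain {z : ℂ} (hz : ‖z‖ < 1) : z ∈ closure slitDomain := by
  have ht : Tendsto (fun ε : ℝ => z + ε * I) (𝓝[>] 0) (𝓝 z) :=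
    ((by fun_prop : Continuous fun ε : ℝ => z + ε * I).tendsto' 0 z (by simp)).mono_left
      nhdsWithin_le_nhds
  by_cases hs : z ∈ slitPlane
  · exact subset_closure ⟨hs, one_sub_mem_slitPlane hz⟩
  · have him : z.im = 0 := by
      rw [mem_slitPlane_iff] at hs
      push Not at hs
      exact hs.2
    refine mem_closure_of_tendsto ht ?_
    filter_upwards [ht (Metric.isOpen_ball.mem_nhds (mem_ball_zero_iff.2 hz)),
      self_mem_nhdsWithin] with ε hε hε0
    refine ⟨Or.inr ?_, one_sub_mem_slitPlane (mem_ball_zero_iff.1 hε)⟩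
    have : (0 : ℝ) < ε := hε0
    simpa [him] using this.ne'

/-- The closed form of the density in the unit disk. -/
theorem density_eq {α β γ a b : ℝ} (ha' : a = parA α β γ) (hb' : b = parB α β γ) (ha : 0 < a)
    (hb : 0 < b) (habc : a + b < α) (hc : α < 1) {z : ℂ} (hz : ‖z‖ < 1) (hz0 : z ≠ 0)
    (hD : (K₁ a b α + connA a b α) * ‖₂F₁ (a : ℂ) (b : ℂ) (α : ℂ) z‖ ^ 2 +
      K₂ a b α * connB a b α ^ 2 * (‖z‖ ^ (2 * (1 - α)) * ‖secondSeries a b α z‖ ^ 2) ≠ 0) :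
    density α β γ z = 1 / (‖z‖ ^ α * ‖1 - z‖ ^ β) * (K₃ a b α /
      ((K₁ a b α + connA a b α) * ‖₂F₁ (a : ℂ) (b : ℂ) (α : ℂ) z‖ ^ 2 +
        K₂ a b α * connB a b α ^ 2 * (‖z‖ ^ (2 * (1 - α)) * ‖secondSeries a b α z‖ ^ 2))) := by
  refine extendFrom_eq (mem_closure_slitDomain hz) ?_
  have hF := (analyticAt_firstSeries ha hb habc hz).continuousAt
  have hG := (analyticAt_secondSeries ha hb habc hc hz).continuousAt
  have h1 : 1 - z ≠ 0 := slitPlane_ne_zero (one_sub_mem_slitPlane hz)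
  have hz0' := norm_ne_zero_iff.2 hz0
  have h1' := norm_ne_zero_iff.2 h1
  have p1 : ContinuousAt (fun z : ℂ => ‖z‖ ^ α) z := continuousAt_id.norm.rpow_const (Or.inl hz0')
  have p2 : ContinuousAt (fun z : ℂ => ‖1 - z‖ ^ β) z :=
    (continuousAt_const.sub continuousAt_id).norm.rpow_const (Or.inl h1')
  have p3 : ContinuousAt (fun z : ℂ => ‖z‖ ^ (2 * (1 - α))) z :=
    continuousAt_id.norm.rpow_const (Or.inl hz0')
  have hc : ContinuousAt (fun z : ℂ => 1 / (‖z‖ ^ α * ‖1 - z‖ ^ β) * (K₃ a b α /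
      ((K₁ a b α + connA a b α) * ‖₂F₁ (a : ℂ) (b : ℂ) (α : ℂ) z‖ ^ 2 +
        K₂ a b α * connB a b α ^ 2 * (‖z‖ ^ (2 * (1 - α)) * ‖secondSeries a b α z‖ ^ 2)))) z :=
    (continuousAt_const.div (p1.mul p2) (mul_ne_zero
      (Real.rpow_pos_of_pos (norm_pos_iff.2 hz0) _).ne'
      (Real.rpow_pos_of_pos (norm_pos_iff.2 h1) _).ne')).mul
    (continuousAt_const.div ((continuousAt_const.mul (hF.norm.pow 2)).add
      (continuousAt_const.mul (p3.mul (hG.norm.pow 2)))) hD)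
  refine (hc.tendsto.mono_left nhdsWithin_le_nhds).congr' ?_
  filter_upwards [self_mem_nhdsWithin,
    nhdsWithin_le_nhds (Metric.isOpen_ball.mem_nhds (mem_ball_zero_iff.2 hz))] with w hw hw1
  simp only [densityFormula, ← ha', ← hb']
  rw [denominator_eq ha hb habc ‹α < 1› (mem_ball_zero_iff.1 hw1) hw.1]

/-- Near the first conical point the density is positive and its logarithm has the normal form
`-(α/2) log |z|² + R - log (1 + k |z|^(2-2α) e^Q)`. -/
theorem logDensity_eq {α β γ a b : ℝ} (ha' : a = parA α β γ) (hb' : b = parB α β γ) (ha : 0 < a)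
    (hb : 0 < b) (habc : a + b < α) (hc : α < 1) :
    ∃ Q q R r, HasHolomorphicWirtinger Q q ∧ HasHolomorphicWirtinger R r ∧ Q 0 = 0 ∧
      ∀ᶠ z in 𝓝[≠] (0 : ℂ), 0 < density α β γ z ∧
        (logDensity α β γ z : ℂ) = -((α / 2 : ℝ) : ℂ) * logNormSq id z + R z -
          log (1 + ((K₂ a b α * connB a b α ^ 2 / (K₁ a b α + connA a b α) : ℝ) : ℂ) *
            exp (((1 - α : ℝ) : ℂ) * logNormSq id z + Q z)) := by
  set F : ℂ → ℂ := ₂F₁ (a : ℂ) (b : ℂ) (α : ℂ) with hFdef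
  set G : ℂ → ℂ := secondSeries a b α with hGdef
  have hF : AnalyticAt ℂ F 0 := analyticAt_firstSeries ha hb habc (by simp)
  have hG : AnalyticAt ℂ G 0 := analyticAt_secondSeries ha hb habc hc (by simp)
  have hF0 : F 0 = 1 := ordinaryHypergeometric_zero _ _ _
  have hG0 : G 0 = 1 := ordinaryHypergeometric_zero _ _ _
  have hF0' : F 0 ≠ 0 := hF0 ▸ one_ne_zero
  have hG0' : G 0 ≠ 0 := hG0 ▸ one_ne_zero
  have hM := K₁_add_connA_pos ha hb habc hc
  have hK3 := K₃_pos ha hb habc hc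
  set M := K₁ a b α + connA a b α with hMdef
  set N := K₂ a b α * connB a b α ^ 2 with hNdef
  have hQ := (HasHolomorphicWirtinger.logNormSq hG hG0').add
    ((HasHolomorphicWirtinger.logNormSq hF hF0').const_mul (-1))
  have hR := ((HasHolomorphicWirtinger.const ((Real.log (K₃ a b α) - Real.log M : ℝ) : ℂ)).add
    ((HasHolomorphicWirtinger.logNormSq (F := fun z => 1 - z)
      (analyticAt_const.sub analyticAt_id) (by simp)).const_mul (-(β / 2)))).add
    ((HasHolomorphicWirtinger.logNormSq hF hF0').const_mul (-1))
  refine ⟨_, _, _, _, hQ, hR, by simp [logNormSq, hF0, hG0], ?_⟩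
  have hball : ∀ᶠ z in 𝓝[≠] (0 : ℂ), ‖z‖ < 1 :=
    eventually_nhdsWithin_of_eventually_nhds (by
      filter_upwards [Metric.ball_mem_nhds (0 : ℂ) one_pos] with z hz
      simpa using hz)
  filter_upwards [hball, self_mem_nhdsWithin,
    eventually_nhdsWithin_of_eventually_nhds (hF.continuousAt.eventually_ne hF0'),
    eventually_nhdsWithin_of_eventually_nhds (hG.continuousAt.eventually_ne hG0'),
    eventually_one_add_exp_mem_slitPlane (k := N / M) (sub_pos.2 hc) hQ] with z hz hz0 hFz hGz hslit
  have hz0 : z ≠ 0 := hz0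
  have h1 : 1 - z ≠ 0 := slitPlane_ne_zero (one_sub_mem_slitPlane hz)
  have hx : 0 < ‖z‖ := norm_pos_iff.2 hz0
  have hy : 0 < ‖1 - z‖ := norm_pos_iff.2 h1
  have hf : 0 < ‖F z‖ := norm_pos_iff.2 hFz
  have hg : 0 < ‖G z‖ := norm_pos_iff.2 hGz
  have hexp : exp (((1 - α : ℝ) : ℂ) * logNormSq id z + (logNormSq G z + ((-1 : ℝ) : ℂ) *
      logNormSq F z)) = ((‖z‖ ^ (2 * (1 - α)) * (‖G z‖ ^ 2 / ‖F z‖ ^ 2) : ℝ) : ℂ) := by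
    rw [exp_add, exp_mul_logNormSq_id _ hz0, logNormSq, logNormSq, ← ofReal_mul, ← ofReal_add,
      ← ofReal_exp, ← ofReal_mul]
    congr 2
    rw [neg_one_mul, ← sub_eq_add_neg, Real.exp_sub, normSq_eq_norm_sq, normSq_eq_norm_sq,
      Real.exp_log (by positivity), Real.exp_log (by positivity)]
  rw [hexp] at hslit ⊢
  set E := ‖z‖ ^ (2 * (1 - α)) * (‖G z‖ ^ 2 / ‖F z‖ ^ 2) with hE
  have hpos : 0 < 1 + N / M * E := by
    rw [← ofReal_mul, ← ofReal_one, ← ofReal_add, ofReal_mem_slitPlane] at hslit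
    exact hslit
  have hD : M * ‖F z‖ ^ 2 + N * (‖z‖ ^ (2 * (1 - α)) * ‖G z‖ ^ 2) =
      M * ‖F z‖ ^ 2 * (1 + N / M * E) := by
    rw [hE]
    field_simp
  have hDpos : 0 < M * ‖F z‖ ^ 2 * (1 + N / M * E) := by positivity
  have hd := density_eq ha' hb' ha hb habc hc hz hz0 (by
    simp only [← hFdef, ← hGdef, ← hMdef, ← hNdef]
    rw [hD]
    exact hDpos.ne')
  simp only [← hFdef, ← hGdef, ← hMdef, ← hNdef] at hd
  rw [hD] at hd
  have hxα := Real.rpow_pos_of_pos hx α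
  have hyβ := Real.rpow_pos_of_pos hy β
  refine ⟨by rw [hd]; positivity, ?_⟩
  rw [← ofReal_mul, ← ofReal_one, ← ofReal_add, ← ofReal_log hpos.le]
  simp only [logNormSq, ← ofReal_mul, ← ofReal_add, ← ofReal_sub, ← ofReal_neg]
  congr 1
  simp only [id, normSq_eq_norm_sq]
  rw [logDensity, hd, Real.log_mul (by positivity) (by positivity), Real.log_div one_ne_zero
    (by positivity), Real.log_div (by positivity) (by positivity), Real.log_mul (by positivity)
    (by positivity), Real.log_mul (by positivity) (by positivity), Real.log_mul (by positivity)
    (by positivity), Real.log_rpow hx, Real.log_rpow hy, Real.log_one, Real.log_pow, Real.log_pow,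
    Real.log_pow]
  push_cast
  ring

theorem prod_range_one_sub (c : ℝ) (n : ℕ) :
    ∏ j ∈ Finset.range (n + 1), (((1 - c : ℝ) : ℂ) - j) =
      (((1 - c) * (-1) ^ n * (ascPochhammer ℝ n).eval c : ℝ) : ℂ) := by
  induction n with
  | zero => simp
  | succ n ih =>
    rw [Finset.prod_range_succ, ih, ascPochhammer_succ_eval]
    push_cast
    ring

end ConicalSphere

theorem mainTheorem3 (α β γ : ℝ) (hα : 0 < α) (hα' : α < 1) (hβ : 0 < β) (hβ' : β < 1)
    (hγ : 0 < γ) (hγ' : γ ≤ 1) (hsum : 2 < α + β + γ)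
    (u : ℂ → ℂ) (hu : u = fun z => ((logDensity α β γ z : ℝ) : ℂ))
    (a b c : ℝ) (ha : a = parA α β γ) (hb : b = parB α β γ) (hc : c = α) :
    -- near the puncture the density is positive and `u` is smooth
    (∀ᶠ z in 𝓝[≠] (0 : ℂ), 0 < density α β γ z ∧ ContDiffAt ℝ ∞ u z) ∧
    (∀ n : ℕ, 1 ≤ n →
      Tendsto (fun z : ℂ => z ^ n * wirtinger^[n] u z) (𝓝[≠] 0)
        (𝓝 ((α / 2 * (-1) ^ n * (n - 1).factorial : ℝ) : ℂ)) ∧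
      Tendsto (fun z : ℂ => (starRingEnd ℂ z) ^ n * wirtingerBar^[n] u z) (𝓝[≠] 0)
        (𝓝 ((α / 2 * (-1) ^ n * (n - 1).factorial : ℝ) : ℂ))) ∧
    (∀ m n : ℕ, 1 ≤ m → 1 ≤ n →
      Tendsto
        (fun z : ℂ => (starRingEnd ℂ z) ^ m * z ^ n * ((‖z‖ ^ (2 * α - 2) : ℝ) : ℂ) *
          wirtingerBar^[m] (wirtinger^[n] u) z) (𝓝[≠] 0)
        (𝓝 (((-1) ^ (n + m) * (ascPochhammer ℝ (n - 1)).eval c *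
          (ascPochhammer ℝ (m - 1)).eval c * K₂ a b c ^ 2 / (1 - K₁ a b c * K₂ a b c) *
          (Real.Gamma c * Real.Gamma (a + b - c + 1) /
            (Real.Gamma a * Real.Gamma b)) ^ 2 : ℝ) : ℂ))) := by
  subst hc
  have ha0 : 0 < a := by rw [ha, parA]; linarith
  have hb0 : 0 < b := by rw [hb, parB]; linarith
  have habc : a + b < c := by rw [ha, hb, parA, parB]; linarith
  have hs : 0 < 1 - c := sub_pos.2 hα'
  obtain ⟨Q, q, R, r, hQ, hR, hQ0, h⟩ := logDensity_eq ha hb ha0 hb0 habc hα'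
  have hu' := h.mono fun z hz => hz.2
  replace hu' : ∀ᶠ z in 𝓝[≠] (0 : ℂ), u z = -((c / 2 : ℝ) : ℂ) * logNormSq id z + R z -
          log (1 + ((K₂ a b c * connB a b c ^ 2 / (K₁ a b c + connA a b c) : ℝ) : ℂ) *
            exp (((1 - c : ℝ) : ℂ) * logNormSq id z + Q z)) := by
    rw [hu]
    exact hu'
  have hreal : ∀ z, starRingEnd ℂ (u z) = u z := fun z => by rw [hu]; simp
  have hlim : ∀ n : ℕ, (-((c / 2 : ℝ) : ℂ) * (-1) ^ n * n.factorial) =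
      ((c / 2 * (-1) ^ (n + 1) * (n + 1 - 1).factorial : ℝ) : ℂ) := fun n => by
    rw [Nat.add_sub_cancel]
    push_cast
    ring
  refine ⟨?_, ?_, ?_⟩
  · filter_upwards [h, contDiffAt_conical hs hQ hR hu'] with z hz hz'
    exact ⟨hz.1, hz'⟩
  · intro n hn
    obtain ⟨n, rfl⟩ := Nat.exists_eq_add_of_le' hn
    rw [← hlim]
    exact ⟨tendsto_wirtinger_conical hs hQ hR hu' n,
      tendsto_wirtingerBar_conical hs hQ hR hu' hreal n⟩
  · intro m n hm hn
    obtain ⟨n, rfl⟩ := Nat.exists_eq_add_of_le' hn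
    obtain ⟨m, rfl⟩ := Nat.exists_eq_add_of_le' hm
    have ht := tendsto_mixed_conical hs hQ hR hu' n m
    rw [show -(2 * (1 - c)) = 2 * c - 2 by ring, hQ0, exp_zero, mul_one, prod_range_one_sub,
      prod_range_one_sub, ← ofReal_mul, ← ofReal_neg, ← ofReal_mul] at ht
    convert ht using 3
    have := neg_connQuotient_eq ha0 hb0 habc hα'
    rw [Nat.add_sub_cancel, Nat.add_sub_cancel]
    rw [mul_div_assoc, mul_assoc, ← this]
    ring
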